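/- **Model.** Let $\mathcal G=(\mathcal C,\mathcal E)$ be a graph. Replace each $C\in\mathcal C$ by a cluster of $n$ nodes, forming a clique, and join all nodes of adjacent clusters. Let $F$ be the set of faulty (Byzantine) nodes, at most $f$ in each cluster, where $n\ge 3f+1$. A pulse sent by a correct node at time $p$ is received by each neighbour (and by the node itself) at a time in $[p+d-U,p+d]$, where $d>0$ and $0\le U\le d$. A correct node $v$ has a locally integrable hardware clock rate $h_v$ with $1\le h_v\le 1+\rho$ and the logical clock $L_v(t)=\int_0^t(1+\varphi\,\delta_v)(1+\mu\gamma_v)h_v\,d\tau$, with $\gamma_v\in\{0,1\}$. **Cluster algorithm.** Round $r$ starts at $t_v(r)$ (with $L_v=0$ and the first round starting at time $0$) and has three phases of logical lengths $\tau_1(r),\tau_2(r),\tau_3(r)$; $v$ sends a pulse at the end of phase 1. In phases 1 and 2, $\delta_v=1$. At the end of phase 2, $\Delta_v(r)$ is the mean of the $(f+1)$-th and the $(n-f)$-th smallest of the $n$ values $\tau_{wv}$, $w\in C$, where $\tau_{wv}$ is the reading of $L_v$ at the reception of $w$'s round $r$ pulse minus its reading at the reception of $v$'s own pulse. (Readings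 stored for faulty $w$, or for pulses not received within phases 1 and 2 of the round, are arbitrary.) In phase 3, $\delta_v=1-(1+\frac1\varphi)\frac{\Delta_v(r)}{\tau_3(r)+\Delta_v(r)}$. For every cluster $A$ adjacent to its own, $v$ simulates this algorithm on the pulses of $A$, with its own hardware clock rate and $\gamma_v$ and without sending pulses; the resulting clock is its estimate $\widetilde L^v_A$. **Intercluster algorithm.** Let $0\le 2\delta<\kappa$. A node $v\in C$ satisfies the fast trigger FT at time $t$ if for some integer $s\ge1$ we have $\widetilde L^v_A-L_v\ge 2s\kappa-\delta$ for some neighbouring cluster $A$ of $C$ and $L_v-\widetilde L^v_B\le 2s\kappa+\delta$ for all neighbouring clusters $B$. It satisfies the slow trigger ST if for some integer $s\ge1$ we have $L_v-\widetilde L^v_A\ge(2s-1)\kappa-\delta$ for some $A$ and $\widetilde L^v_B-L_v\le(2s-1)\kappa+\delta$ for all $B$. At the beginning of each round, $v$ sets $\gamma_v=1$ if FT holds, else $\gamma_v=0$ if ST holds, and otherwise keeps $\gamma_v$ (its value before the first round is arbitrary). **Cluster clocks and conditions.** $L_C(t)=\frac12\big(\max_{v\in C\setminus F}L_v(t)+\min_{v\in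 C\setminus F}L_v(t)\big)$. The fast condition FC (slow condition SC) of $C$ at time $t$ is obtained from FT (ST) by replacing $L_v,\widetilde L^v_A,\widetilde L^v_B$ by $L_C,L_A,L_B$ and $\delta$ by $0$. **Faithful executions.** Let $k\in\mathbb N$. The execution is faithful if for all correct $v\in C$ and all $t>0$, with $r_t$ the current round of $v$ at time $t$: if $C$ satisfies FC (SC) at $t$, then $v$ satisfies FT (ST) at all times in $[t_v(r_t-k),t_v(r_t)]$, where $t_v(r_t-k)$ is replaced by $0$ if there are fewer than $k$ rounds before round $r_t$. **Parameters.** For $c_2\ge 32$ and $\rho>0$ put $\mu=c_2\rho$, $c_1=\frac1\varphi=\frac{1/2-1/4096}{1+c_2}\cdot\frac1\rho$, $\vartheta_g=(1+\rho)(1+\mu)$, $\zeta_{\max}=(1+\varphi)(1+\mu)$, $\gamma=(1+\mu)(\vartheta_g-1)$, $$\alpha=\frac{2\vartheta_g^2+5\vartheta_g-5}{2(\vartheta_g+1)(1-\gamma)}+\frac{\gamma}{1-\gamma}(1+c_1),\qquad \beta=\frac{\gamma}{1-\gamma}d+\frac{(3\vartheta_g-1)+\gamma c_1}{1-\gamma}U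 .$$ Let $e$ be a sequence, indexed by the rounds, with $e(r+1)=\alpha e(r)+\beta$ and initial value at least $\frac{\beta}{1-\alpha}$. Put $\tau_1(r)=\zeta_{\max}\vartheta_g e(r)$, $\tau_2(r)=\zeta_{\max}\vartheta_g(e(r)+d)$, $\tau_3(r)=c_1\zeta_{\max}\vartheta_g(e(r)+U)$. **Proposition.** For every $c_2\ge32$ there are $\rho_0>0$ and $k_0\in\mathbb N$, depending only on $c_2$, such that for all $0<\rho\le\rho_0$ and $k\ge k_0$ the following holds for all $\mathcal G,n,f,F,d,U,\kappa,\delta,e$ as above. In every execution that is faithful (with $k$), the cluster clocks $L_C$ satisfy the GCS axioms with $\bar\rho=(1+\varphi)(1+\tfrac14\mu)-1>0$ and $\bar\mu=(1+\varphi)(1+\tfrac78\mu)-1>0$: for all $C\in\mathcal C$ and $t\ge0$, * (A1) $1\le\frac{d}{dt}L_C(t)\le(1+\bar\rho)(1+\bar\mu)$; * (A2) if $C$ satisfies SC at time $t$, then $\frac{d}{dt}L_C(t)\le1+\bar\rho$; * (A3) if $C$ satisfies FC at time $t$, then $\frac{d}{dt}L_C(t)\ge1+\bar\mu$; * (A4)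 $\bar\mu/\bar\rho>1$. Hence the cluster clocks implement (simulate an execution of) gradient clock synchronization on $\mathcal G$. Since $L_C$ need not be differentiable everywhere, bounds on $\frac{d}{dt}L_C(t)$ mean that all limit points of the difference quotients of $L_C$ at $t$ (taken within $[0,\infty)$) satisfy them. -/

import Mathlib

open Filter Topology MeasureTheory

noncomputable section

namespace ClusterGCS

/-! ### The network -/

/-- Nodes of the augmented network: every cluster (a node of the base graph) consists of `n` nodes. -/
abbrev Node (C : Type*) (n : ℕ) := C × Fin n

/-- The augmented network: clusters are cliques, adjacent clusters are completely connected. -/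
def augmentedGraph {C : Type*} (G : SimpleGraph C) (n : ℕ) : SimpleGraph (Node C n) where
  Adj v w := v ≠ w ∧ (v.1 = w.1 ∨ G.Adj v.1 w.1)
  symm := ⟨fun _ _ h => ⟨h.1.symm, h.2.imp Eq.symm fun a => a.symm⟩⟩
  loopless := ⟨fun _ h => h.1 rfl⟩

/-- The clusters whose pulses `v` processes: its own and the adjacent ones. -/
def Listens {C : Type*} {n : ℕ} (G : SimpleGraph C) (v : Node C n) (A : C) : Prop :=
  A = v.1 ∨ G.Adj v.1 A

/-! ### Parameters -/

/-- Parameters of the model and of the algorithm. Rounds are numbered `0, 1, 2, …`. -/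
structure Params where
  /-- number of nodes per cluster -/
  n : ℕ
  /-- bound on the number of faulty nodes per cluster -/
  f : ℕ
  /-- hardware clock drift -/
  rho : ℝ
  /-- speedup in fast mode -/
  mu : ℝ
  /-- weight of the amortized cluster corrections -/
  phi : ℝ
  /-- maximal message delay -/
  d : ℝ
  /-- delay uncertainty -/
  U : ℝ
  /-- skew unit of the fast and slow conditions -/
  kappa : ℝ
  /-- slack of the triggers -/
  delta : ℝ
  /-- logical duration of phase 1 -/
  tau1 : ℕ → ℝ
  /-- logical duration of phase 2 -/
  tau2 : ℕ → ℝ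
  /-- logical duration of phase 3 -/
  tau3 : ℕ → ℝ

namespace Params

/-- Logical length of round `r`. -/
def T (P : Params) (r : ℕ) : ℝ := P.tau1 r + P.tau2 r + P.tau3 r

/-- Logical time at which round `r` begins: the sum of the lengths of the previous rounds. -/
def roundStart (P : Params) (r : ℕ) : ℝ := ∑ i ∈ Finset.range r, P.T i

end Params

/-- `c₁ = (1/2 - ε) / ((1 + c₂) ρ)` with `ε = 1/4096`. -/
def c1 (c2 rho : ℝ) : ℝ := (1 / 2 - 1 / 4096) / (1 + c2) * (1 / rho)

def phiOf (c2 rho : ℝ) : ℝ := 1 / c1 c2 rho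

def muOf (c2 rho : ℝ) : ℝ := c2 * rho

/-- `ϑ_g = (1 + ρ)(1 + μ)`. -/
def thetaG (c2 rho : ℝ) : ℝ := (1 + rho) * (1 + muOf c2 rho)

/-- `ζ_max = (1 + φ)(1 + μ)`. -/
def zetaMax (c2 rho : ℝ) : ℝ := (1 + phiOf c2 rho) * (1 + muOf c2 rho)

/-- `γ = (ζ_max / ζ) (ϑ_g / ϑ) (ϑ - 1)` for `ζ = 1 + φ` and `ϑ = ϑ_g`. -/
def gammaG (c2 rho : ℝ) : ℝ :=
  zetaMax c2 rho / (1 + phiOf c2 rho) * (thetaG c2 rho / thetaG c2 rho) * (thetaG c2 rho - 1)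

/-- Contraction factor of the bound on the pulse diameter. -/
def alphaG (c2 rho : ℝ) : ℝ :=
  (2 * thetaG c2 rho ^ 2 + 5 * thetaG c2 rho - 5) /
      (2 * (thetaG c2 rho + 1) * (1 - gammaG c2 rho))
    + gammaG c2 rho / (1 - gammaG c2 rho) * (1 + c1 c2 rho)

/-- Additive error of the bound on the pulse diameter. -/
def betaG (c2 rho d U : ℝ) : ℝ :=
  gammaG c2 rho / (1 - gammaG c2 rho) * d
    + 1 / (1 - gammaG c2 rho) * ((3 * thetaG c2 rho - 1) + gammaG c2 rho * c1 c2 rho) * U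

/-- Steady state error `β_g / (1 - α_g)`. -/
def steadyError (c2 rho d U : ℝ) : ℝ := betaG c2 rho d U / (1 - alphaG c2 rho)

/-- Error bounds `e(r + 1) = α_g e(r) + β_g` from an initial bound. -/
def errorBound (c2 rho d U e0 : ℝ) : ℕ → ℝ
  | 0 => e0
  | r + 1 => alphaG c2 rho * errorBound c2 rho d U e0 r + betaG c2 rho d U

/-- The parameter choice: `μ = c₂ ρ`, `φ = 1 / c₁`, and phase lengths determined by the errors. -/
def paramsOf (n f : ℕ) (c2 rho d U e0 kappa delta : ℝ) : Params where
  n := n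
  f := f
  rho := rho
  mu := muOf c2 rho
  phi := phiOf c2 rho
  d := d
  U := U
  kappa := kappa
  delta := delta
  tau1 r := zetaMax c2 rho * thetaG c2 rho * errorBound c2 rho d U e0 r
  tau2 r := zetaMax c2 rho * thetaG c2 rho * (errorBound c2 rho d U e0 r + d)
  tau3 r := c1 c2 rho * zetaMax c2 rho * thetaG c2 rho * (errorBound c2 rho d U e0 r + U)

/-! ### Executions -/

/-- The `j`-th smallest value of `x`, counted from `0`, with multiplicity. -/
def orderStat {n : ℕ} (x : Fin n → ℝ) (j : ℕ) : ℝ :=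
  if h : j < n then x (Tuple.sort x ⟨j, h⟩) else 0

/-- The first time `t ≥ 0` at which the clock `L` shows at least `x`; it is `⊤` if there is none. -/
def hittingTime (L : ℝ → ℝ) (x : ℝ) : EReal :=
  sInf ((fun t : ℝ => (t : EReal)) '' {t : ℝ | 0 ≤ t ∧ x ≤ L t})

/-- The data of an execution. A node `v` runs the cluster algorithm for its own cluster, and, without
sending pulses, simulates it for every adjacent cluster `A`; the entries indexed by `v` and `A`
belong to that run. -/
structure Trace (C : Type*) (P : Params) where
  /-- hardware clock rates -/
  h : Node C P.n → ℝ → ℝ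
  /-- rate corrections made by the cluster algorithm -/
  corr : Node C P.n → C → ℝ → ℝ
  /-- fast (`1`) or slow (`0`) mode as a function of time -/
  gam : Node C P.n → ℝ → ℝ
  /-- the mode chosen at the beginning of a round (`true` is fast) -/
  mode : Node C P.n → ℕ → Bool
  /-- `delay u v r` is the delay of the round `r` pulse from `u` to `v` -/
  delay : Node C P.n → Node C P.n → ℕ → ℝ
  /-- delay after which `v` registers its own (possibly only virtual) round `r` pulse in a run -/
  loop : Node C P.n → C → ℕ → ℝ
  /-- `reading v A i r`: clock reading that `v` stores for the round `r` pulse of node `(A, i)` -/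
  reading : Node C P.n → C → Fin P.n → ℕ → ℝ
  /-- `selfReading v A r`: clock reading that `v` stores for its own round `r` pulse in the run for `A` -/
  selfReading : Node C P.n → C → ℕ → ℝ

namespace Trace

variable {C : Type*} {P : Params}

/-- Logical clock of the run of `v` for the cluster `A`. -/
def clock (X : Trace C P) (v : Node C P.n) (A : C) (t : ℝ) : ℝ :=
  ∫ s in (0 : ℝ)..t, (1 + P.phi * X.corr v A s) * (1 + P.mu * X.gam v s) * X.h v s

/-- The logical clock `L_v`. -/
def L (X : Trace C P) (v : Node C P.n) : ℝ → ℝ := X.clock v v.1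

/-- Time at which round `r` begins in the run of `v` for `A`. -/
def start (X : Trace C P) (v : Node C P.n) (A : C) (r : ℕ) : EReal :=
  hittingTime (X.clock v A) (P.roundStart r)

/-- End of phase 1 of round `r`, when the pulse of the round is sent. -/
def pulse (X : Trace C P) (v : Node C P.n) (A : C) (r : ℕ) : EReal :=
  hittingTime (X.clock v A) (P.roundStart r + P.tau1 r)

/-- End of phase 2 of round `r`. -/
def phase2End (X : Trace C P) (v : Node C P.n) (A : C) (r : ℕ) : EReal :=
  hittingTime (X.clock v A) (P.roundStart r + P.tau1 r + P.tau2 r)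

/-- The correction `Δ_v(r)`: midpoint of the `(f+1)`-th and the `(n-f)`-th smallest relative
reception time. -/
def Delta (X : Trace C P) (v : Node C P.n) (A : C) (r : ℕ) : ℝ :=
  (orderStat (fun i => X.reading v A i r - X.selfReading v A r) P.f
    + orderStat (fun i => X.reading v A i r - X.selfReading v A r) (P.n - P.f - 1)) / 2

/-- The fast trigger of `v` at time `t`; `X.clock v A` is the estimate of the clock of cluster `A`. -/
def FastTrigger (G : SimpleGraph C) (X : Trace C P) (v : Node C P.n) (t : ℝ) : Prop :=
  ∃ s : ℕ, 1 ≤ s ∧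
    (∃ A, G.Adj v.1 A ∧ X.clock v A t - X.L v t ≥ 2 * s * P.kappa - P.delta) ∧
    ∀ B, G.Adj v.1 B → X.L v t - X.clock v B t ≤ 2 * s * P.kappa + P.delta

/-- The slow trigger of `v` at time `t`. -/
def SlowTrigger (G : SimpleGraph C) (X : Trace C P) (v : Node C P.n) (t : ℝ) : Prop :=
  ∃ s : ℕ, 1 ≤ s ∧
    (∃ A, G.Adj v.1 A ∧ X.L v t - X.clock v A t ≥ (2 * s - 1) * P.kappa - P.delta) ∧
    ∀ B, G.Adj v.1 B → X.clock v B t - X.L v t ≤ (2 * s - 1) * P.kappa + P.delta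

/-- The correct node `v` runs the cluster algorithm for cluster `A` (really if `A` is its own
cluster, and as a silent simulation otherwise). Nothing is required of the readings stored for
faulty nodes, or for pulses that do not arrive between the beginning of the round and the end of
its phase 2. -/
structure RunsClusterSync (F : Set (Node C P.n)) (X : Trace C P) (v : Node C P.n) (A : C) :
    Prop where
  /-- readings for the pulses of correct nodes of `A` -/
  reading_eq : ∀ (r : ℕ) (i : Fin P.n) (p : ℝ), (A, i) ∉ F → X.pulse (A, i) A r = p →
    X.start v A r ≤ ((p + X.delay (A, i) v r : ℝ) : EReal) →
    ((p + X.delay (A, i) v r : ℝ) : EReal) < X.phase2End v A r →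
    X.reading v A i r = X.clock v A (p + X.delay (A, i) v r)
  /-- the reading for the node's own pulse -/
  selfReading_eq : ∀ (r : ℕ) (p : ℝ), X.pulse v A r = p →
    X.start v A r ≤ ((p + X.loop v A r : ℝ) : EReal) →
    ((p + X.loop v A r : ℝ) : EReal) < X.phase2End v A r →
    X.selfReading v A r = X.clock v A (p + X.loop v A r)
  loop_mem : ∀ r, X.loop v A r ∈ Set.Icc (P.d - P.U) P.d
  /-- phases 1 and 2 -/
  corr_eq_one : ∀ (r : ℕ) (t : ℝ), X.start v A r ≤ t → (t : EReal) < X.phase2End v A r →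
    X.corr v A t = 1
  /-- phase 3 -/
  corr_eq : ∀ (r : ℕ) (t : ℝ), X.phase2End v A r ≤ t → (t : EReal) < X.start v A (r + 1) →
    X.corr v A t = 1 - (1 + 1 / P.phi) * (X.Delta v A r / (P.tau3 r + X.Delta v A r))

/-- The correct node `v` chooses its mode by the intercluster algorithm. -/
structure RunsInterclusterSync (G : SimpleGraph C) (X : Trace C P) (v : Node C P.n) : Prop where
  fast : ∀ (r : ℕ) (t : ℝ), X.start v v.1 r = t → X.FastTrigger G v t → X.mode v r = true
  slow : ∀ (r : ℕ) (t : ℝ), X.start v v.1 r = t → ¬ X.FastTrigger G v t → X.SlowTrigger G v t →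
    X.mode v r = false
  keep : ∀ (r : ℕ) (t : ℝ), X.start v v.1 (r + 1) = t → ¬ X.FastTrigger G v t →
    ¬ X.SlowTrigger G v t → X.mode v (r + 1) = X.mode v r
  gam_eq : ∀ (r : ℕ) (t : ℝ), X.start v v.1 r ≤ t → (t : EReal) < X.start v v.1 (r + 1) →
    X.gam v t = if X.mode v r then 1 else 0

/-- `X` is an execution of the intercluster algorithm with the faulty nodes `F`, about whose
behaviour nothing is assumed. All logical clocks are `0` at time `0`. -/
structure IsExecution (G : SimpleGraph C) (F : Set (Node C P.n)) (X : Trace C P) : Prop where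
  h_integrable : ∀ v ∉ F, LocallyIntegrable (X.h v) volume
  h_mem : ∀ v ∉ F, ∀ t, X.h v t ∈ Set.Icc 1 (1 + P.rho)
  delay_mem : ∀ u ∉ F, ∀ v ∉ F, u = v ∨ (augmentedGraph G P.n).Adj u v →
    ∀ r, X.delay u v r ∈ Set.Icc (P.d - P.U) P.d
  /-- in the run for its own cluster, a node registers its own pulse like those of the others -/
  loop_eq : ∀ v ∉ F, ∀ r, X.loop v v.1 r = X.delay v v r
  selfReading_eq : ∀ v ∉ F, ∀ r, X.selfReading v v.1 r = X.reading v v.1 v.2 r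
  cluster : ∀ v ∉ F, ∀ A, Listens G v A → X.RunsClusterSync F v A
  intercluster : ∀ v ∉ F, X.RunsInterclusterSync G v

/-- The cluster clock: the mean of the largest and the smallest correct logical clock. -/
def clusterClock (F : Set (Node C P.n)) (X : Trace C P) (A : C) (t : ℝ) : ℝ :=
  (sSup {x | ∃ i : Fin P.n, (A, i) ∉ F ∧ x = X.L (A, i) t}
    + sInf {x | ∃ i : Fin P.n, (A, i) ∉ F ∧ x = X.L (A, i) t}) / 2

end Trace

/-! ### The axioms of gradient clock synchronization -/

section Axioms

variable {C : Type*}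

/-- The fast condition of the cluster `A` at time `t`. -/
def FastCondition (G : SimpleGraph C) (kappa : ℝ) (L : C → ℝ → ℝ) (A : C) (t : ℝ) : Prop :=
  ∃ s : ℕ, 1 ≤ s ∧ (∃ B, G.Adj A B ∧ L B t - L A t ≥ 2 * s * kappa) ∧
    ∀ B, G.Adj A B → L A t - L B t ≤ 2 * s * kappa

/-- The slow condition of the cluster `A` at time `t`. -/
def SlowCondition (G : SimpleGraph C) (kappa : ℝ) (L : C → ℝ → ℝ) (A : C) (t : ℝ) : Prop :=
  ∃ s : ℕ, 1 ≤ s ∧ (∃ B, G.Adj A B ∧ L A t - L B t ≥ (2 * s - 1) * kappa) ∧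
    ∀ B, G.Adj A B → L B t - L A t ≤ (2 * s - 1) * kappa

/-- All derivative numbers (limit points of difference quotients) of `L` at `t`, within `[0, ∞)`, are
at least `a`; if `L` is differentiable at `t`, this says that its derivative is at least `a`. -/
def RateAtLeast (L : ℝ → ℝ) (t a : ℝ) : Prop :=
  ∀ b < a, ∀ᶠ t' in 𝓝[Set.Ici 0 \ {t}] t, b < (L t' - L t) / (t' - t)

/-- All derivative numbers of `L` at `t`, within `[0, ∞)`, are at most `a`. -/
def RateAtMost (L : ℝ → ℝ) (t a : ℝ) : Prop :=
  ∀ b > a, ∀ᶠ t' in 𝓝[Set.Ici 0 \ {t}] t, (L t' - L t) / (t' - t) < b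

/-- The axioms (A1)-(A4) for logical clocks `L` on `G`, with the constants `rho` and `mu`. -/
structure GCSAxioms (G : SimpleGraph C) (kappa rho mu : ℝ) (L : C → ℝ → ℝ) : Prop where
  rho_pos : 0 < rho
  mu_pos : 0 < mu
  A1 : ∀ A, ∀ t ≥ 0, RateAtLeast (L A) t 1 ∧ RateAtMost (L A) t ((1 + rho) * (1 + mu))
  A2 : ∀ A, ∀ t ≥ 0, SlowCondition G kappa L A t → RateAtMost (L A) t (1 + rho)
  A3 : ∀ A, ∀ t ≥ 0, FastCondition G kappa L A t → RateAtLeast (L A) t (1 + mu)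
  A4 : 1 < mu / rho

/-- The clocks `L` are those of an execution of gradient clock synchronization on `G`. -/
def ImplementsGCS (G : SimpleGraph C) (kappa : ℝ) (L : C → ℝ → ℝ) : Prop :=
  ∃ rho mu : ℝ, GCSAxioms G kappa rho mu L

end Axioms

/-- Faithful executions: whenever the cluster of a correct node `v` satisfies the fast (slow)
condition at time `t`, then `v` has satisfied the fast (slow) trigger from the beginning of the
`k`-th round before its current round `r` (of its first round, if there are fewer than `k` earlier
rounds; here `r - k` is truncated subtraction) until the beginning of round `r`. -/
def Trace.IsFaithful {C : Type*} {P : Params} (G : SimpleGraph C) (F : Set (Node C P.n)) (k : ℕ)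
    (X : Trace C P) : Prop :=
  ∀ v ∉ F, ∀ t : ℝ, 0 < t → ∀ r : ℕ, IsGreatest {j : ℕ | X.start v v.1 j ≤ t} r →
    (FastCondition G P.kappa (X.clusterClock F) v.1 t →
      ∀ t' : ℝ, X.start v v.1 (r - k) ≤ t' → t' ≤ X.start v v.1 r → X.FastTrigger G v t') ∧
    (SlowCondition G P.kappa (X.clusterClock F) v.1 t →
      ∀ t' : ℝ, X.start v v.1 (r - k) ≤ t' → t' ≤ X.start v v.1 r → X.SlowTrigger G v t')

end ClusterGCS

end

noncomputable section

namespace ClusterGCS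

/-! ### Order statistics -/

/-! Within a cluster the algorithm is approximate agreement on pulse times. Suppose the correct
pulses of a round are spread over time `D ≤ e r`. The median of the correct pulses separates the two
order statistics in the correction: up to delay uncertainty and drift, one lies between the earliest
pulse and the median, the other between the median and the latest pulse. So all nodes aim at a
common interval of length about `D / 2` (`midpointStat_bounds`). The next spread is about `D / 2`,
plus `O(U)`, plus the drift `(1 - 1 / θ) * (T / c)` over the logical time `T` between pulses, for
rates in `[c, c θ]` (`Trace.spread_succ`). The phases are long enough to receive all correct pulses
and to absorb the corrections, so by induction no round stalls and the spread never exceeds `e r`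
(`Trace.all_rounds`).

This contraction is used twice. For arbitrary modes, `θ = (1 + ρ)(1 + μ)` and `T / c` is about `c₁
e`; drift costs about `c₁ (ρ + μ) e = (1/2 - 1/4096) e`, so the contraction factor is barely below
`1` and `e` is large compared with `U` and `ρ d`. If the nodes of a cluster share a mode, `θ = 1 +
ρ` and drift costs only about `c₁ ρ e < e / 66`. Six such rounds bring the spread below `e / 20`
(`Trace.spread_of_sameMode`). As `c₁ μ` is nearly `1/2`, corrections then change phase 3 rates by a
relative amount of about `0.104 μ` at most. This leaves slow clusters below `(1 + φ)(1 + μ / 4)` and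
fast ones above `(1 + φ)(1 + 7 μ / 8)` (`Trace.rate_bounds_of_modeSettled`).

Faithfulness turns a cluster condition into a mode that every correct node has held for its last `k`
rounds; the quality of the estimates enters only there. Nodes of a cluster can be in different
rounds, which costs two rounds of common history and gives `k₀ = 6 + 2`. Rate bounds near `t` become
bounds on increments, which pass to the maximum and minimum of the clocks
(`Trace.clusterClock_le_add`). The numerical conditions are verified in `SmallDrift.tuned`. -/

theorem orderStat_le {n j : ℕ} (x : Fin n → ℝ) {B : ℝ} (hj : j < n)
    (h : j < (Finset.univ.filter fun i => x i ≤ B).card) : orderStat x j ≤ B := by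
  classical
  rw [orderStat, dif_pos hj]
  by_contra! hB
  have hsub : (Finset.univ.filter fun i => x i ≤ B) ⊆
      (Finset.Iio (⟨j, hj⟩ : Fin n)).image (Tuple.sort x) := by
    intro i hi
    rw [Finset.mem_filter] at hi
    refine Finset.mem_image.2 ⟨(Tuple.sort x).symm i, ?_, by simp⟩
    rw [Finset.mem_Iio]
    by_contra! hle
    have := Tuple.monotone_sort x hle
    simp only [Function.comp_apply, Equiv.apply_symm_apply] at this
    linarith [hi.2]
  have := (Finset.card_le_card hsub).trans Finset.card_image_le
  rw [Fin.card_Iio] at this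
  simp only at this
  omega

theorem le_orderStat {n j : ℕ} (x : Fin n → ℝ) {B : ℝ} (hj : j < n)
    (h : n ≤ j + (Finset.univ.filter fun i => B ≤ x i).card) : B ≤ orderStat x j := by
  classical
  rw [orderStat, dif_pos hj]
  by_contra! hB
  have hsub : (Finset.univ.filter fun i => B ≤ x i) ⊆
      (Finset.Ioi (⟨j, hj⟩ : Fin n)).image (Tuple.sort x) := by
    intro i hi
    rw [Finset.mem_filter] at hi
    refine Finset.mem_image.2 ⟨(Tuple.sort x).symm i, ?_, by simp⟩
    rw [Finset.mem_Ioi]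
    by_contra! hle
    have := Tuple.monotone_sort x hle
    simp only [Function.comp_apply, Equiv.apply_symm_apply] at this
    linarith [hi.2]
  have := (Finset.card_le_card hsub).trans Finset.card_image_le
  rw [Fin.card_Ioi] at this
  simp only at this
  omega

/-- A median of `p` over `K`: more than `f` indices are at most, and more than `f` at least, as
large. -/
theorem exists_median {ι : Type*} (K : Finset ι) (p : ι → ℝ) {f : ℕ} (hK : 2 * f + 1 ≤ K.card) :
    ∃ m ∈ K, f < (K.filter fun i => p i ≤ p m).card ∧ f < (K.filter fun i => p m ≤ p i).card := by
  classical
  have hne : (K.filter fun i => f < (K.filter fun j => p j ≤ p i).card).Nonempty := by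
    obtain ⟨i, hi, hmax⟩ := K.exists_max_image p (Finset.card_pos.1 (by omega))
    refine ⟨i, Finset.mem_filter.2 ⟨hi, ?_⟩⟩
    rw [Finset.filter_true_of_mem hmax]
    omega
  -- If more than `f` values were strictly below this minimal choice, the largest of them would
  -- already qualify.
  obtain ⟨m, hm, hmin⟩ := Finset.exists_min_image _ p hne
  rw [Finset.mem_filter] at hm
  refine ⟨m, hm.1, hm.2, ?_⟩
  have hlt : (K.filter fun i => p i < p m).card ≤ f := by
    by_contra! hf
    obtain ⟨j, hj, hjmax⟩ := Finset.exists_max_image (K.filter fun i => p i < p m) p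
      (Finset.card_pos.1 (by omega))
    rw [Finset.mem_filter] at hj
    have hsub : (K.filter fun i => p i < p m) ⊆ K.filter fun i => p i ≤ p j := fun i hi =>
      Finset.mem_filter.2 ⟨(Finset.mem_filter.1 hi).1, hjmax i hi⟩
    have := hmin j (Finset.mem_filter.2 ⟨hj.1, hf.trans_le (Finset.card_le_card hsub)⟩)
    linarith [hj.2]
  have hsum := Finset.card_filter_add_card_filter_not (s := K) (fun i => p i < p m)
  simp only [not_lt] at hsum
  omega

/-! ### The midpoint rule -/

/-- The mean of the `(f+1)`-th and the `(n-f)`-th smallest value. -/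
def midpointStat {n : ℕ} (f : ℕ) (y : Fin n → ℝ) : ℝ :=
  (orderStat y f + orderStat y (n - f - 1)) / 2

section Midpoint

variable {n f : ℕ} {K : Finset (Fin n)} {p y : Fin n → ℝ} {m : Fin n} {lo D pv c θ U : ℝ}

/-- The value `y` could be the elapsed reading of a clock with rates in `[c, c θ]` over a time that
is `z` up to an error of `U`. -/
def ReadsElapsed (c θ U z y : ℝ) : Prop :=
  ∃ w, |w - z| ≤ U ∧ y ≤ c * max w (θ * w) ∧ c * min w (θ * w) ≤ y

theorem ReadsElapsed.le {z y B : ℝ} (h : ReadsElapsed c θ U z y) (hc : 0 < c) (hθ : 1 ≤ θ)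
    (hz : z + U ≤ B) : y ≤ c * max B (θ * B) := by
  obtain ⟨w, hw, h1, -⟩ := h
  have hwB : w ≤ B := by linarith [(abs_le.1 hw).2]
  refine h1.trans (mul_le_mul_of_nonneg_left (max_le_max hwB ?_) hc.le)
  exact mul_le_mul_of_nonneg_left hwB (by linarith)

theorem ReadsElapsed.ge {z y B : ℝ} (h : ReadsElapsed c θ U z y) (hc : 0 < c) (hθ : 1 ≤ θ)
    (hz : B ≤ z - U) : c * min B (θ * B) ≤ y := by
  obtain ⟨w, hw, -, h2⟩ := h
  have hwB : B ≤ w := by linarith [(abs_le.1 hw).1]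
  refine le_trans (mul_le_mul_of_nonneg_left (min_le_min hwB ?_) hc.le) h2
  exact mul_le_mul_of_nonneg_left hwB (by linarith)

/-- Counting correct indices suffices. Those up to the median bound the `(f+1)`-th value from above,
those from the median on bound the `(n-f)`-th from below; the two outer bounds use that at most `f`
values are arbitrary. -/
theorem orderStat_bounds (hn : 3 * f + 1 ≤ n) (hK : n ≤ K.card + f)
    (hm1 : f < (K.filter fun i => p i ≤ p m).card) (hm2 : f < (K.filter fun i => p m ≤ p i).card)
    (hp : ∀ i ∈ K, lo ≤ p i ∧ p i ≤ lo + D) (hc : 0 < c) (hθ : 1 ≤ θ)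
    (hy : ∀ i ∈ K, ReadsElapsed c θ U (p i - pv) (y i)) :
    (orderStat y f ≤ c * max (p m - pv + U) (θ * (p m - pv + U)) ∧
      c * min (lo - pv - U) (θ * (lo - pv - U)) ≤ orderStat y f) ∧
    (orderStat y (n - f - 1) ≤ c * max (lo + D - pv + U) (θ * (lo + D - pv + U)) ∧
      c * min (p m - pv - U) (θ * (p m - pv - U)) ≤ orderStat y (n - f - 1)) := by
  refine ⟨⟨orderStat_le _ (by omega) ?_, le_orderStat _ (by omega) ?_⟩,
    orderStat_le _ (by omega) ?_, le_orderStat _ (by omega) ?_⟩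
  · refine hm1.trans_le (Finset.card_le_card fun i hi => ?_)
    rw [Finset.mem_filter] at hi
    exact Finset.mem_filter.2 ⟨Finset.mem_univ _, (hy i hi.1).le hc hθ (by linarith [hi.2])⟩
  · have : K.card ≤ (Finset.univ.filter fun i =>
        c * min (lo - pv - U) (θ * (lo - pv - U)) ≤ y i).card :=
      Finset.card_le_card fun i hi =>
        Finset.mem_filter.2 ⟨Finset.mem_univ _, (hy i hi).ge hc hθ (by linarith [(hp i hi).1])⟩
    omega
  · have : K.card ≤ (Finset.univ.filter fun i =>
        y i ≤ c * max (lo + D - pv + U) (θ * (lo + D - pv + U))).card :=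
      Finset.card_le_card fun i hi =>
        Finset.mem_filter.2 ⟨Finset.mem_univ _, (hy i hi).le hc hθ (by linarith [(hp i hi).2])⟩
    omega
  · have : (K.filter fun i => p m ≤ p i).card ≤ (Finset.univ.filter fun i =>
        c * min (p m - pv - U) (θ * (p m - pv - U)) ≤ y i).card := by
      refine Finset.card_le_card fun i hi => ?_
      rw [Finset.mem_filter] at hi
      exact Finset.mem_filter.2 ⟨Finset.mem_univ _, (hy i hi.1).ge hc hθ (by linarith [hi.2])⟩
    omega

/-- The right and left outer sides do not mention `pv`, so nodes with different pulse times get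
common targets. The upper target is scaled by the slowest rate `c` and the lower one by the fastest
rate `c θ`, because these give the latest and the earliest next pulse in `diameter_step`. -/
theorem midpointStat_bounds (hn : 3 * f + 1 ≤ n) (hK : n ≤ K.card + f) (hmK : m ∈ K)
    (hm1 : f < (K.filter fun i => p i ≤ p m).card) (hm2 : f < (K.filter fun i => p m ≤ p i).card)
    (hp : ∀ i ∈ K, lo ≤ p i ∧ p i ≤ lo + D) (hpv : lo ≤ pv ∧ pv ≤ lo + D)
    (hc : 0 < c) (hθ : 1 ≤ θ) (hU : 0 ≤ U)
    (hy : ∀ i ∈ K, ReadsElapsed c θ U (p i - pv) (y i)) :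
    c * pv + midpointStat f y ≤ c * ((p m + lo + D) / 2 + U + (θ - 1) * (D + U)) ∧
    c * θ * ((p m + lo) / 2 - U - (θ - 1) / 2 * D) ≤ c * θ * pv + midpointStat f y ∧
    |midpointStat f y| ≤ c * θ * (D + U) := by
  obtain ⟨⟨h1, h2⟩, h3, h4⟩ := orderStat_bounds hn hK hm1 hm2 hp hc hθ hy
  obtain ⟨hm3, hm4⟩ := hp m hmK
  obtain ⟨hv1, hv2⟩ := hpv
  have hx : 0 ≤ θ - 1 := by linarith
  rw [midpointStat]
  set a := orderStat y f
  set b := orderStat y (n - f - 1)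
  have key1 : max (p m - pv + U) (θ * (p m - pv + U)) ≤ (p m - pv + U) + (θ - 1) * (D + U) := by
    apply max_le
    · nlinarith
    · nlinarith
  have key2 : max (lo + D - pv + U) (θ * (lo + D - pv + U)) ≤
      (lo + D - pv + U) + (θ - 1) * (D + U) := by
    apply max_le
    · nlinarith
    · nlinarith
  have key3 : θ * (lo - pv - U) ≤ min (lo - pv - U) (θ * (lo - pv - U)) := by
    apply le_min
    · nlinarith
    · exact le_rfl
  have key4 : θ * (p m - pv - U) - (θ - 1) * D ≤ min (p m - pv - U) (θ * (p m - pv - U)) := by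
    apply le_min
    · nlinarith
    · nlinarith
  have g1 := h1.trans (mul_le_mul_of_nonneg_left key1 hc.le)
  have g2 := (mul_le_mul_of_nonneg_left key3 hc.le).trans h2
  have g3 := h3.trans (mul_le_mul_of_nonneg_left key2 hc.le)
  have g4 := (mul_le_mul_of_nonneg_left key4 hc.le).trans h4
  have hD : 0 ≤ D := by linarith
  have hcD : 0 ≤ c * (θ - 1) * D * (θ - 1) := by positivity
  have hcx : 0 ≤ c * (θ - 1) := by positivity
  refine ⟨by nlinarith, by nlinarith, ?_⟩
  have b1 : ∀ z, z ≤ D + U → c * max z (θ * z) ≤ c * θ * (D + U) := by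
    intro z hz
    rw [mul_assoc]
    refine mul_le_mul_of_nonneg_left (max_le ?_ ?_) hc.le
    · nlinarith
    · nlinarith
  have b2 : ∀ z, -(D + U) ≤ z → -(c * θ * (D + U)) ≤ c * min z (θ * z) := by
    intro z hz
    rw [mul_assoc, ← mul_neg]
    refine mul_le_mul_of_nonneg_left (le_min ?_ ?_) hc.le
    · nlinarith
    · nlinarith
  have := h1.trans (b1 _ (by linarith))
  have := h3.trans (b1 _ (by linarith))
  have := (b2 _ (by linarith)).trans h2
  have := (b2 _ (by linarith)).trans h4
  rw [abs_le]
  constructor <;> linarith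

/-- One step of approximate agreement: `p' - pv` is the time in which a clock with rates in
`[c, c θ]` advances by `T + Δ`. -/
theorem diameter_step {pw pv' pw' Δv Δw T M : ℝ} (hc : 0 < c) (hθ : 1 ≤ θ)
    (hv : c * pv + Δv ≤ c * ((M + lo + D) / 2 + U + (θ - 1) * (D + U)))
    (hw : c * θ * ((M + lo) / 2 - U - (θ - 1) / 2 * D) ≤ c * θ * pw + Δw)
    (hv' : c * (pv' - pv) ≤ T + Δv) (hw' : T + Δw ≤ c * θ * (pw' - pw)) :
    pv' - pw' ≤ D / 2 + 2 * U + (θ - 1) * (3 / 2 * D + U) + (1 - 1 / θ) * (T / c) := by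
  have hθ0 : 0 < θ := by linarith
  have e1 : pv' ≤ (M + lo + D) / 2 + U + (θ - 1) * (D + U) + T / c := by
    rw [← mul_le_mul_iff_right₀ hc, mul_add c _ (T / c), mul_div_cancel₀ _ hc.ne']
    linarith
  have e2 : (M + lo) / 2 - U - (θ - 1) / 2 * D + 1 / θ * (T / c) ≤ pw' := by
    have hcθ : 0 < c * θ := by positivity
    rw [← mul_le_mul_iff_right₀ hcθ, mul_add (c * θ)]
    have : c * θ * (1 / θ * (T / c)) = T := by field_simp
    rw [this]
    linarith
  linarith

end Midpoint

/-! ### Hitting times -/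

theorem hittingTime_mono (L : ℝ → ℝ) {x y : ℝ} (h : x ≤ y) : hittingTime L x ≤ hittingTime L y :=
  sInf_le_sInf (Set.image_mono fun _ ht => ⟨ht.1, h.trans ht.2⟩)

theorem lt_of_lt_hittingTime {L : ℝ → ℝ} {x t : ℝ} (ht : 0 ≤ t)
    (h : (t : EReal) < hittingTime L x) : L t < x := by
  by_contra! hx
  exact absurd h (not_lt.2 (sInf_le ⟨t, ⟨ht, hx⟩, rfl⟩))

theorem hittingTime_eq_of_isLeast {L : ℝ → ℝ} {x b : ℝ} (h : IsLeast {t : ℝ | 0 ≤ t ∧ x ≤ L t} b) :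
    hittingTime L x = b := by
  refine IsLeast.csInf_eq ⟨⟨b, h.1, rfl⟩, ?_⟩
  rintro _ ⟨t, ht, rfl⟩
  exact EReal.coe_le_coe_iff.2 (h.2 ht)

section Primitive

variable {f L : ℝ → ℝ}

/-- A finite hitting time of a primitive is attained, even if the integrand is not integrable
everywhere. -/
theorem hittingTime_cases (hL : ∀ t, L t = ∫ s in (0 : ℝ)..t, f s) {x : ℝ} (hx : 0 ≤ x) :
    hittingTime L x = ⊤ ∨
      ∃ b : ℝ, 0 ≤ b ∧ hittingTime L x = b ∧ L b = x ∧ IntervalIntegrable f volume 0 b := by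
  have hL0 : L 0 = 0 := by rw [hL, intervalIntegral.integral_same]
  rcases Set.eq_empty_or_nonempty {t : ℝ | 0 ≤ t ∧ x ≤ L t} with hS | ⟨t₀, ht₀, hxt₀⟩
  · left
    rw [hittingTime, hS, Set.image_empty, sInf_empty]
  right
  rcases hx.eq_or_lt with rfl | hx
  · exact ⟨0, le_rfl, hittingTime_eq_of_isLeast ⟨⟨le_rfl, hL0.ge⟩, fun t ht => ht.1⟩, hL0,
      IntervalIntegrable.refl⟩
  -- The integral of a non-integrable function is `0` by convention, so reaching a positive value
  -- forces integrability up to `t₀`.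
  have hint : IntervalIntegrable f volume 0 t₀ := by
    by_contra hni
    have := hL t₀
    rw [intervalIntegral.integral_undef hni] at this
    linarith
  have hcont : ContinuousOn L (Set.Icc 0 t₀) := by
    have := intervalIntegral.continuousOn_primitive_interval' hint Set.left_mem_uIcc
    rw [Set.uIcc_of_le ht₀] at this
    exact this.congr fun t _ => hL t
  have hclosed : IsClosed (Set.Icc 0 t₀ ∩ L ⁻¹' Set.Ici x) :=
    hcont.preimage_isClosed_of_isClosed isClosed_Icc isClosed_Ici
  have hcomp : IsCompact (Set.Icc 0 t₀ ∩ L ⁻¹' Set.Ici x) :=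
    isCompact_Icc.of_isClosed_subset hclosed Set.inter_subset_left
  obtain ⟨b, ⟨hb, hxb⟩, hmin⟩ := hcomp.exists_isLeast ⟨t₀, ⟨ht₀, le_rfl⟩, hxt₀⟩
  have hleast : IsLeast {t : ℝ | 0 ≤ t ∧ x ≤ L t} b := by
    refine ⟨⟨hb.1, hxb⟩, fun t ht => ?_⟩
    rcases le_total t t₀ with h | h
    · exact hmin ⟨⟨ht.1, h⟩, ht.2⟩
    · exact hb.2.trans h
  refine ⟨b, hb.1, hittingTime_eq_of_isLeast hleast, le_antisymm ?_ hxb, ?_⟩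
  · obtain ⟨t, ht, htx⟩ := intermediate_value_Icc hb.1
      (hcont.mono (Set.Icc_subset_Icc_right hb.2)) (show x ∈ Set.Icc (L 0) (L b) from
        ⟨by rw [hL0]; exact hx.le, hxb⟩)
    have : b = t := le_antisymm (hleast.2 ⟨ht.1, htx.ge⟩) ht.2
    rw [this, htx]
  · refine hint.mono_set ?_
    rw [Set.uIcc_of_le hb.1, Set.uIcc_of_le ht₀]
    exact Set.Icc_subset_Icc_right hb.2

variable {g : ℝ → ℝ} {c θ : ℝ}

theorem integral_bounds_of_eqOn (hg : LocallyIntegrable g volume) (hgm : ∀ s, g s ∈ Set.Icc 1 θ)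
    (hc : 0 ≤ c) {s t : ℝ} (hst : s ≤ t) (hf : ∀ u ∈ Set.Ioo s t, f u = c * g u) :
    IntervalIntegrable f volume s t ∧ c * (t - s) ≤ ∫ u in s..t, f u ∧
      ∫ u in s..t, f u ≤ c * θ * (t - s) := by
  have hgi : IntervalIntegrable (fun u => c * g u) volume s t :=
    (hg.integrableOn_isCompact isCompact_uIcc).intervalIntegrable.const_mul c
  have hfi : IntervalIntegrable f volume s t := by
    refine hgi.congr_uIoo fun u hu => ?_
    rw [Set.uIoo_of_le hst] at hu
    exact (hf u hu).symm
  have hconst : ∀ k : ℝ, ∫ _ in s..t, k = k * (t - s) := fun k => by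
    rw [intervalIntegral.integral_const, smul_eq_mul, mul_comm]
  refine ⟨hfi, ?_, ?_⟩
  · rw [← hconst]
    refine intervalIntegral.integral_mono_on_of_le_Ioo hst (by simp) hfi fun u hu => ?_
    rw [hf u hu]
    nlinarith [(hgm u).1]
  · rw [← hconst]
    refine intervalIntegral.integral_mono_on_of_le_Ioo hst hfi (by simp) fun u hu => ?_
    rw [hf u hu]
    exact mul_le_mul_of_nonneg_left (hgm u).2 hc

/-- A clock that runs at rates in `[c, c θ]` until it shows `y` does show `y` at some time. -/
theorem hittingTime_advance (hL : ∀ t, L t = ∫ s in (0 : ℝ)..t, f s)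
    (hg : LocallyIntegrable g volume) (hgm : ∀ s, g s ∈ Set.Icc 1 θ) (hc : 0 < c)
    {x y a : ℝ} (hx : 0 ≤ x) (hxy : x < y) (ha : hittingTime L x = a)
    (hf : ∀ s : ℝ, a ≤ s → (s : EReal) < hittingTime L y → f s = c * g s) :
    ∃ b : ℝ, hittingTime L y = b ∧ a < b ∧ 0 ≤ a ∧ L a = x ∧ L b = y ∧
      IntervalIntegrable f volume 0 b ∧
      ∀ s t, a ≤ s → s ≤ t → t ≤ b → c * (t - s) ≤ L t - L s ∧ L t - L s ≤ c * θ * (t - s) := by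
  obtain ⟨ha0, hLa, hia⟩ : 0 ≤ a ∧ L a = x ∧ IntervalIntegrable f volume 0 a := by
    rcases hittingTime_cases hL hx with h | ⟨b, h0, h1, h2, h3⟩
    · rw [h] at ha
      exact absurd ha.symm (EReal.coe_ne_top a)
    · rw [h1, EReal.coe_eq_coe_iff] at ha
      rw [← ha]
      exact ⟨h0, h2, h3⟩
  -- The rate is known only before the clock shows `y`. The conditional bound serves twice: to
  -- exclude an infinite hitting time, since at the slowest rate `y` is reached by `a + (y - x) /
  -- c`, and to give the final slopes.
  have step : ∀ s t, a ≤ s → s ≤ t → (∀ u ∈ Set.Ioo a t, (u : EReal) < hittingTime L y) →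
      c * (t - s) ≤ L t - L s ∧ L t - L s ≤ c * θ * (t - s) := by
    intro s t has hst hu
    have e1 := integral_bounds_of_eqOn (f := f) hg hgm hc.le has
      fun u hu' => hf u hu'.1.le (hu u ⟨hu'.1, hu'.2.trans_le hst⟩)
    have e2 := integral_bounds_of_eqOn (f := f) hg hgm hc.le hst
      fun u hu' => hf u (has.trans hu'.1.le) (hu u ⟨has.trans_lt hu'.1, hu'.2⟩)
    rw [hL t, hL s, intervalIntegral.integral_interval_sub_left
      ((hia.trans e1.1).trans e2.1) (hia.trans e1.1)]
    exact e2.2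
  rcases hittingTime_cases hL (hx.trans hxy.le) with h | ⟨b, hb0, hb, hLb, hib⟩
  · exfalso
    have h1 : a ≤ a + (y - x) / c := by
      have : 0 < (y - x) / c := div_pos (by linarith) hc
      linarith
    have h2 := (step a (a + (y - x) / c) le_rfl h1 fun u _ => by
      rw [h]; exact EReal.coe_lt_top u).1
    rw [add_sub_cancel_left, mul_div_cancel₀ _ hc.ne'] at h2
    have h3 : L (a + (y - x) / c) < y := lt_of_lt_hittingTime (ha0.trans h1) (by
      rw [h]; exact EReal.coe_lt_top _)
    linarith
  · have hab : a < b := by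
      have h1 := hittingTime_mono L hxy.le
      rw [ha, hb, EReal.coe_le_coe_iff] at h1
      refine lt_of_le_of_ne h1 fun h => ?_
      rw [h] at hLa
      linarith
    refine ⟨b, hb, hab, ha0, hLa, hLb, hib, fun s t has hst htb => step s t has hst fun u hu => ?_⟩
    rw [hb, EReal.coe_lt_coe_iff]
    exact hu.2.trans_le htb

end Primitive

/-! ### The rounds of a node -/

/-- Drift, speedups and phase lengths are positive. -/
structure Params.Regular (P : Params) : Prop where
  rho_pos : 0 < P.rho
  mu_pos : 0 < P.mu
  phi_pos : 0 < P.phi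
  tau1_pos : ∀ r, 0 < P.tau1 r
  tau2_pos : ∀ r, 0 < P.tau2 r
  tau3_pos : ∀ r, 0 < P.tau3 r

theorem Params.roundStart_succ (P : Params) (r : ℕ) :
    P.roundStart (r + 1) = P.roundStart r + P.tau1 r + P.tau2 r + P.tau3 r := by
  rw [Params.roundStart, Finset.sum_range_succ, Params.T, Params.roundStart]
  ring

theorem Params.Regular.roundStart_nonneg {P : Params} (hP : P.Regular) (r : ℕ) :
    0 ≤ P.roundStart r :=
  Finset.sum_nonneg fun i _ => by
    have := hP.tau1_pos i
    have := hP.tau2_pos i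
    have := hP.tau3_pos i
    rw [Params.T]
    linarith

namespace Trace

variable {C : Type*} {P : Params} {G : SimpleGraph C} {F : Set (Node C P.n)} {X : Trace C P}
  {A : C} {i : Fin P.n} {r : ℕ}

/-- `1` in fast and `0` in slow mode. -/
def modeNum (X : Trace C P) (A : C) (i : Fin P.n) (r : ℕ) : ℝ := if X.mode (A, i) r then 1 else 0

/-- The factor between hardware and logical clock rate of `(A, i)` in phases 1 and 2 of round `r`. -/
def nominal (X : Trace C P) (A : C) (i : Fin P.n) (r : ℕ) : ℝ :=
  (1 + P.phi) * (1 + P.mu * X.modeNum A i r)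

/-- The rate of the logical clock of `(A, i)`. -/
def rate (X : Trace C P) (A : C) (i : Fin P.n) (s : ℝ) : ℝ :=
  (1 + P.phi * X.corr (A, i) A s) * (1 + P.mu * X.gam (A, i) s) * X.h (A, i) s

/-- The correction of `(A, i)` in the run for its own cluster. -/
def ownDelta (X : Trace C P) (A : C) (i : Fin P.n) (r : ℕ) : ℝ := X.Delta (A, i) A r

/-- Real-valued versions of the times at which the phases begin. -/
def startTime (X : Trace C P) (A : C) (i : Fin P.n) (r : ℕ) : ℝ := (X.start (A, i) A r).toReal

def pulseTime (X : Trace C P) (A : C) (i : Fin P.n) (r : ℕ) : ℝ := (X.pulse (A, i) A r).toReal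

def endTime (X : Trace C P) (A : C) (i : Fin P.n) (r : ℕ) : ℝ := (X.phase2End (A, i) A r).toReal

theorem modeNum_mem (X : Trace C P) (A : C) (i : Fin P.n) (r : ℕ) :
    X.modeNum A i r ∈ Set.Icc (0 : ℝ) 1 := by
  rw [modeNum]; split <;> simp

theorem nominal_bounds (hP : P.Regular) (X : Trace C P) (A : C) (i : Fin P.n) (r : ℕ) :
    1 + P.phi ≤ X.nominal A i r ∧ X.nominal A i r ≤ (1 + P.phi) * (1 + P.mu) := by
  obtain ⟨h0, h1⟩ := X.modeNum_mem A i r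
  have := hP.mu_pos
  have := hP.phi_pos
  rw [nominal]
  constructor
  · have : 0 ≤ P.mu * X.modeNum A i r := by positivity
    nlinarith
  · gcongr
    nlinarith

theorem nominal_pos (hP : P.Regular) (X : Trace C P) (A : C) (i : Fin P.n) (r : ℕ) :
    0 < X.nominal A i r := by
  linarith [(X.nominal_bounds hP A i r).1, hP.phi_pos]

theorem clock_eq (X : Trace C P) (A : C) (i : Fin P.n) (t : ℝ) :
    X.clock (A, i) A t = ∫ s in (0 : ℝ)..t, X.rate A i s := rfl

theorem start_zero (X : Trace C P) (A : C) (i : Fin P.n) : X.start (A, i) A 0 = ((0 : ℝ) : EReal) := by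
  refine hittingTime_eq_of_isLeast ⟨⟨le_rfl, ?_⟩, fun t ht => ht.1⟩
  rw [clock_eq, intervalIntegral.integral_same, Params.roundStart, Finset.sum_range_zero]

/-- The rate of the clock while the pulse of round `r` is sent and received. -/
theorem rate_phase12 (hP : P.Regular) (hX : X.IsExecution G F) (hi : (A, i) ∉ F) {s : ℝ}
    (h1 : X.start (A, i) A r ≤ s) (h2 : (s : EReal) < X.phase2End (A, i) A r) :
    X.rate A i s = X.nominal A i r * X.h (A, i) s := by
  have h3 : (s : EReal) < X.start (A, i) A (r + 1) := by
    refine h2.trans_le (hittingTime_mono _ ?_)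
    rw [P.roundStart_succ]
    linarith [hP.tau3_pos r]
  rw [rate, (hX.cluster _ hi A (Or.inl rfl)).corr_eq_one r s h1 h2,
    (hX.intercluster _ hi).gam_eq r s h1 h3, nominal, modeNum, mul_one]

/-- The correction is designed so that `1 + φ δ = (1 + φ) τ₃ / (τ₃ + Δ)`: passing the logical length
`τ₃` takes as long as `τ₃ + Δ` would at the nominal rate. -/
theorem rate_phase3 (hP : P.Regular) (hX : X.IsExecution G F) (hi : (A, i) ∉ F) {s : ℝ}
    (h1 : X.phase2End (A, i) A r ≤ s) (h2 : (s : EReal) < X.start (A, i) A (r + 1))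
    (hΔ : 0 < P.tau3 r + X.ownDelta A i r) :
    X.rate A i s =
      X.nominal A i r * (P.tau3 r / (P.tau3 r + X.ownDelta A i r)) * X.h (A, i) s := by
  have h3 : X.start (A, i) A r ≤ s := by
    refine le_trans (hittingTime_mono _ ?_) h1
    linarith [hP.tau1_pos r, hP.tau2_pos r]
  rw [rate, (hX.cluster _ hi A (Or.inl rfl)).corr_eq r s h1 h2,
    (hX.intercluster _ hi).gam_eq r s h3 h2, nominal, modeNum]
  change (1 + P.phi * (1 - (1 + 1 / P.phi) *
    (X.ownDelta A i r / (P.tau3 r + X.ownDelta A i r)))) * _ * _ = _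
  have := hP.phi_pos
  have : P.phi ≠ 0 := this.ne'
  have := hΔ.ne'
  field_simp
  ring

/-- Round `r` of the node `(A, i)` up to the end of its phase 2. -/
structure Listening (X : Trace C P) (A : C) (i : Fin P.n) (r : ℕ) : Prop where
  start_eq : X.start (A, i) A r = X.startTime A i r
  pulse_eq : X.pulse (A, i) A r = X.pulseTime A i r
  end_eq : X.phase2End (A, i) A r = X.endTime A i r
  start_nonneg : 0 ≤ X.startTime A i r
  start_lt : X.startTime A i r < X.pulseTime A i r
  pulse_lt : X.pulseTime A i r < X.endTime A i r
  clock_pulse : X.clock (A, i) A (X.pulseTime A i r) - X.clock (A, i) A (X.startTime A i r)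
    = P.tau1 r
  clock_end : X.clock (A, i) A (X.endTime A i r) - X.clock (A, i) A (X.pulseTime A i r) = P.tau2 r
  slope : ∀ s t, X.startTime A i r ≤ s → s ≤ t → t ≤ X.endTime A i r →
    X.nominal A i r * (t - s) ≤ X.clock (A, i) A t - X.clock (A, i) A s ∧
    X.clock (A, i) A t - X.clock (A, i) A s ≤ X.nominal A i r * (1 + P.rho) * (t - s)

/-- A finite start suffices: in phases 1 and 2 the rate is at least the nominal one, whatever the
other nodes do. -/
theorem listening (hP : P.Regular) (hX : X.IsExecution G F) (hi : (A, i) ∉ F)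
    (hs : X.start (A, i) A r ≠ ⊤) : X.Listening A i r := by
  have h0 := hP.roundStart_nonneg r
  have h1 := hP.tau1_pos r
  have h2 := hP.tau2_pos r
  have hs' : X.start (A, i) A r = X.startTime A i r := by
    rcases hittingTime_cases (X.clock_eq A i) h0 with h | ⟨b, -, hb, -⟩
    · exact absurd h hs
    · rw [startTime, start, hb, EReal.toReal_coe]
  obtain ⟨q, hq, hsq, hs0, hLs, hLq, -, hslope⟩ :=
    hittingTime_advance (y := P.roundStart r + P.tau1 r + P.tau2 r) (X.clock_eq A i)
      (hX.h_integrable _ hi) (hX.h_mem _ hi) (X.nominal_pos hP A i r) h0 (by linarith) hs'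
      fun s hs1 hs2 => rate_phase12 hP hX hi (by rw [hs']; exact EReal.coe_le_coe_iff.2 hs1) hs2
  have hq' : q = X.endTime A i r := by rw [endTime, phase2End, hq, EReal.toReal_coe]
  rw [hq'] at hq hsq hLq hslope
  obtain ⟨p, hp, hsp, -, -, hLp, -⟩ :=
    hittingTime_advance (y := P.roundStart r + P.tau1 r) (X.clock_eq A i)
      (hX.h_integrable _ hi) (hX.h_mem _ hi) (X.nominal_pos hP A i r) h0 (by linarith) hs'
      fun s hs1 hs2 => rate_phase12 hP hX hi (by rw [hs']; exact EReal.coe_le_coe_iff.2 hs1)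
        (hs2.trans_le (hittingTime_mono _ (by linarith)))
  have hp' : p = X.pulseTime A i r := by rw [pulseTime, pulse, hp, EReal.toReal_coe]
  rw [hp'] at hp hsp hLp
  have hpq : X.pulseTime A i r < X.endTime A i r := by
    have := hittingTime_mono (X.clock (A, i) A)
      (show P.roundStart r + P.tau1 r ≤ P.roundStart r + P.tau1 r + P.tau2 r by linarith)
    rw [hp, hq, EReal.coe_le_coe_iff] at this
    refine lt_of_le_of_ne this fun h => ?_
    rw [h] at hLp
    linarith
  exact ⟨hs', hp, hq, hs0, hsp, hpq, by linarith, by linarith, hslope⟩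

/-- The end of round `r`, and the duration of its phase 3. -/
structure Finishing (X : Trace C P) (A : C) (i : Fin P.n) (r : ℕ) : Prop where
  start_eq : X.start (A, i) A (r + 1) = X.startTime A i (r + 1)
  end_lt : X.endTime A i r < X.startTime A i (r + 1)
  integrable : IntervalIntegrable (X.rate A i) volume 0 (X.startTime A i (r + 1))
  duration_le : X.nominal A i r * (X.startTime A i (r + 1) - X.endTime A i r)
    ≤ P.tau3 r + X.ownDelta A i r
  le_duration : P.tau3 r + X.ownDelta A i r
    ≤ X.nominal A i r * (1 + P.rho) * (X.startTime A i (r + 1) - X.endTime A i r)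

/-- Positivity of `τ₃ + Δ` keeps the phase 3 rate positive, so the phase ends. -/
theorem Listening.finishing (hP : P.Regular) (hX : X.IsExecution G F) (hi : (A, i) ∉ F)
    (h : X.Listening A i r) (hΔ : 0 < P.tau3 r + X.ownDelta A i r) : X.Finishing A i r := by
  have h0 := hP.roundStart_nonneg r
  have h1 := hP.tau1_pos r
  have h2 := hP.tau2_pos r
  have h3 := hP.tau3_pos r
  have hc : 0 < X.nominal A i r * (P.tau3 r / (P.tau3 r + X.ownDelta A i r)) :=
    mul_pos (X.nominal_pos hP A i r) (div_pos h3 hΔ)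
  obtain ⟨b, hb, hqb, -, hLq, hLb, hint, hslope⟩ :=
    hittingTime_advance (x := P.roundStart r + P.tau1 r + P.tau2 r) (y := P.roundStart (r + 1))
      (X.clock_eq A i) (hX.h_integrable _ hi) (hX.h_mem _ hi) hc (by linarith)
      (by rw [P.roundStart_succ]; linarith) h.end_eq
      fun s hs1 hs2 => rate_phase3 hP hX hi (by rw [h.end_eq]; exact EReal.coe_le_coe_iff.2 hs1)
        hs2 hΔ
  have hb' : b = X.startTime A i (r + 1) := by rw [startTime, start, hb, EReal.toReal_coe]
  rw [hb'] at hb hqb hLb hint hslope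
  obtain ⟨g1, g2⟩ := hslope _ _ le_rfl hqb.le le_rfl
  rw [hLb, hLq, P.roundStart_succ, add_sub_cancel_left] at g1 g2
  refine ⟨hb, hqb, hint, ?_, ?_⟩
  · have : X.nominal A i r * (P.tau3 r / (P.tau3 r + X.ownDelta A i r)) *
        (X.startTime A i (r + 1) - X.endTime A i r) =
        X.nominal A i r * (X.startTime A i (r + 1) - X.endTime A i r) *
          (P.tau3 r / (P.tau3 r + X.ownDelta A i r)) := by ring
    rw [this, mul_div_assoc', div_le_iff₀ hΔ] at g1
    nlinarith
  · have : X.nominal A i r * (P.tau3 r / (P.tau3 r + X.ownDelta A i r)) * (1 + P.rho) *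
        (X.startTime A i (r + 1) - X.endTime A i r) =
        X.nominal A i r * (1 + P.rho) * (X.startTime A i (r + 1) - X.endTime A i r) *
          (P.tau3 r / (P.tau3 r + X.ownDelta A i r)) := by ring
    rw [this, mul_div_assoc', le_div_iff₀ hΔ] at g2
    nlinarith

end Trace

/-! ### The rounds of a cluster -/

/-- Upper bound on the logical clock rates in phases 1 and 2. -/
def Params.maxRate (P : Params) : ℝ := (1 + P.phi) * (1 + P.mu) * (1 + P.rho)

/-- The ratio between the largest and the smallest rate in phases 1 and 2. -/
def Params.theta (P : Params) : ℝ := (1 + P.rho) * (1 + P.mu)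

/-- The phase lengths fit the bounds `e r` on the spread of the pulses of round `r`. -/
structure Params.Fits (P : Params) (e : ℕ → ℝ) : Prop extends P.Regular where
  U_nonneg : 0 ≤ P.U
  U_le : P.U ≤ P.d
  e_nonneg : ∀ r, 0 ≤ e r
  tau1_ge : ∀ r, P.maxRate * e r ≤ P.tau1 r
  tau2_gt : ∀ r, P.maxRate * (e r + P.d) < P.tau2 r
  tau3_gt : ∀ r, P.maxRate * (e r + P.U) < P.tau3 r
  init : (1 - 1 / P.theta) * (P.tau1 0 / (1 + P.phi)) ≤ e 0
  step : ∀ r, e r / 2 + 2 * P.U + (P.theta - 1) * (3 / 2 * e r + P.U) +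
    (1 - 1 / P.theta) * ((P.tau2 r + P.tau3 r + P.tau1 (r + 1)) / (1 + P.phi)) ≤ e (r + 1)

/-- At most a third of the nodes of every cluster are faulty. -/
structure FewFaults {C : Type*} (P : Params) (F : Set (Node C P.n)) : Prop where
  n_ge : 3 * P.f + 1 ≤ P.n
  ncard_le : ∀ A : C, {i : Fin P.n | (A, i) ∈ F}.ncard ≤ P.f

open Classical in
/-- The correct nodes of a cluster. -/
def correct {C : Type*} {n : ℕ} (F : Set (Node C n)) (A : C) : Finset (Fin n) :=
  Finset.univ.filter fun i => (A, i) ∉ F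

theorem mem_correct {C : Type*} {n : ℕ} {F : Set (Node C n)} {A : C} {i : Fin n} :
    i ∈ correct F A ↔ (A, i) ∉ F := by
  simp [correct]

theorem FewFaults.card_correct {C : Type*} {P : Params} {F : Set (Node C P.n)}
    (h : FewFaults P F) (A : C) : P.n ≤ (correct F A).card + P.f := by
  classical
  have h1 := h.ncard_le A
  rw [Set.ncard_eq_toFinset_card', Set.toFinset_ofPred] at h1
  have h2 := Finset.card_filter_add_card_filter_not (s := (Finset.univ : Finset (Fin P.n)))
    (fun i => (A, i) ∈ F)
  rw [Finset.card_univ, Fintype.card_fin] at h2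
  have h3 : correct F A = Finset.univ.filter fun i => (A, i) ∉ F := by
    ext i; simp [mem_correct]
  rw [h3]
  omega

theorem FewFaults.exists_correct {C : Type*} {P : Params} {F : Set (Node C P.n)}
    (h : FewFaults P F) (A : C) : ∃ i, (A, i) ∉ F := by
  have h1 := h.card_correct A
  have h2 := h.n_ge
  obtain ⟨i, hi⟩ := Finset.card_pos.1 (show 0 < (correct F A).card by omega)
  exact ⟨i, mem_correct.1 hi⟩

namespace Trace

variable {C : Type*} {P : Params} {G : SimpleGraph C} {F : Set (Node C P.n)} {X : Trace C P}
  {A : C} {i j : Fin P.n} {r : ℕ} {e : ℕ → ℝ} {c θ D : ℝ}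

/-- All correct nodes of `A` take part in round `r`. -/
def AllListening (F : Set (Node C P.n)) (X : Trace C P) (A : C) (r : ℕ) : Prop :=
  ∀ i, (A, i) ∉ F → X.Listening A i r

/-- The pulses of round `r` of the correct nodes of `A` are sent within time `D`. -/
def SpreadLE (F : Set (Node C P.n)) (X : Trace C P) (A : C) (r : ℕ) (D : ℝ) : Prop :=
  ∀ i j, (A, i) ∉ F → (A, j) ∉ F → X.pulseTime A i r - X.pulseTime A j r ≤ D

/-- In phases 1 and 2 of round `r`, the clocks of the correct nodes of `A` have rates in
`[c, c θ]`. -/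
def RatesIn (F : Set (Node C P.n)) (X : Trace C P) (A : C) (r : ℕ) (c θ : ℝ) : Prop :=
  ∀ i, (A, i) ∉ F → c ≤ X.nominal A i r ∧ X.nominal A i r * (1 + P.rho) ≤ c * θ

theorem ratesIn_theta (hP : P.Regular) (F : Set (Node C P.n)) (X : Trace C P) (A : C) (r : ℕ) :
    X.RatesIn F A r (1 + P.phi) P.theta := fun i _ => by
  obtain ⟨h1, h2⟩ := X.nominal_bounds hP A i r
  refine ⟨h1, ?_⟩
  have := mul_le_mul_of_nonneg_right h2 (show 0 ≤ 1 + P.rho by linarith [hP.rho_pos])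
  rw [Params.theta]
  linarith

theorem one_lt_theta (hP : P.Regular) : 1 < P.theta := by
  have := hP.rho_pos
  have := hP.mu_pos
  rw [Params.theta]
  nlinarith

theorem Listening.clock_bounds (h : X.Listening A i r) {s t : ℝ}
    (hs : X.startTime A i r ≤ s) (hst : s ≤ t) (ht : t ≤ X.endTime A i r)
    (hc : c ≤ X.nominal A i r) (hθ : X.nominal A i r * (1 + P.rho) ≤ c * θ) :
    c * (t - s) ≤ X.clock (A, i) A t - X.clock (A, i) A s ∧
    X.clock (A, i) A t - X.clock (A, i) A s ≤ c * θ * (t - s) := by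
  obtain ⟨h1, h2⟩ := h.slope s t hs hst ht
  have := sub_nonneg.2 hst
  exact ⟨le_trans (mul_le_mul_of_nonneg_right hc this) h1,
    h2.trans (mul_le_mul_of_nonneg_right hθ this)⟩

theorem nominal_le_maxRate (hP : P.Regular) (X : Trace C P) (A : C) (i : Fin P.n) (r : ℕ) :
    X.nominal A i r * (1 + P.rho) ≤ P.maxRate :=
  mul_le_mul_of_nonneg_right (X.nominal_bounds hP A i r).2 (by linarith [hP.rho_pos])

theorem maxRate_pos (hP : P.Regular) : 0 < P.maxRate := by
  have := hP.rho_pos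
  have := hP.mu_pos
  have := hP.phi_pos
  rw [Params.maxRate]
  positivity

/-- Phases 1 and 2 are long enough to receive all pulses of the round. -/
theorem Listening.windows (hP : P.Fits e) (h : X.Listening A i r) :
    e r ≤ X.pulseTime A i r - X.startTime A i r ∧
      e r + P.d < X.endTime A i r - X.pulseTime A i r := by
  have hmax := maxRate_pos hP.toRegular
  have hnom := X.nominal_le_maxRate hP.toRegular A i r
  constructor
  · have h1 := (h.slope _ _ le_rfl h.start_lt.le h.pulse_lt.le).2
    rw [h.clock_pulse] at h1
    have h2 := mul_le_mul_of_nonneg_right hnom (sub_nonneg.2 h.start_lt.le)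
    exact le_of_mul_le_mul_left (((hP.tau1_ge r).trans h1).trans h2) hmax
  · have h1 := (h.slope _ _ h.start_lt.le h.pulse_lt.le le_rfl).2
    rw [h.clock_end] at h1
    have h2 := mul_le_mul_of_nonneg_right hnom (sub_nonneg.2 h.pulse_lt.le)
    exact lt_of_mul_lt_mul_left (((hP.tau2_gt r).trans_le h1).trans_le h2) hmax.le

/-- The reading for the pulse of a correct node is taken within the round. -/
theorem reading_eq_clock (hP : P.Fits e) (hX : X.IsExecution G F) (hl : X.AllListening F A r)
    (hD : X.SpreadLE F A r (e r)) (hi : (A, i) ∉ F) (hj : (A, j) ∉ F) :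
    X.startTime A i r ≤ X.pulseTime A j r + X.delay (A, j) (A, i) r ∧
    X.pulseTime A j r + X.delay (A, j) (A, i) r < X.endTime A i r ∧
    X.delay (A, j) (A, i) r ∈ Set.Icc (P.d - P.U) P.d ∧
    X.reading (A, i) A j r =
      X.clock (A, i) A (X.pulseTime A j r + X.delay (A, j) (A, i) r) := by
  have hdel : X.delay (A, j) (A, i) r ∈ Set.Icc (P.d - P.U) P.d := by
    refine hX.delay_mem _ hj _ hi ?_ r
    by_cases hij : ((A, j) : Node C P.n) = (A, i)
    · exact Or.inl hij
    · exact Or.inr ⟨hij, Or.inl rfl⟩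
  obtain ⟨w1, w2⟩ := (hl i hi).windows hP
  have := hD i j hi hj
  have := hD j i hj hi
  have := hP.U_le
  have h1 : X.startTime A i r ≤ X.pulseTime A j r + X.delay (A, j) (A, i) r := by
    linarith [hdel.1]
  have h2 : X.pulseTime A j r + X.delay (A, j) (A, i) r < X.endTime A i r := by
    linarith [hdel.2]
  refine ⟨h1, h2, hdel, (hX.cluster _ hi A (Or.inl rfl)).reading_eq r j _ hj (hl j hj).pulse_eq
    ?_ ?_⟩
  · rw [(hl i hi).start_eq]
    exact EReal.coe_le_coe_iff.2 h1
  · rw [(hl i hi).end_eq]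
    exact EReal.coe_lt_coe_iff.2 h2

/-- Two delays differ by at most `U`, and both readings are taken by one clock during phases 1 and
2. The elapsed time is negative if the other pulse arrives first, hence the maximum and minimum in
`ReadsElapsed`. -/
theorem readsElapsed (hP : P.Fits e) (hX : X.IsExecution G F) (hl : X.AllListening F A r)
    (hD : X.SpreadLE F A r (e r)) (hi : (A, i) ∉ F) (hj : (A, j) ∉ F) (hc : 0 < c) (hθ : 1 ≤ θ)
    (hr : X.RatesIn F A r c θ) :
    ReadsElapsed c θ P.U (X.pulseTime A j r - X.pulseTime A i r)
      (X.reading (A, i) A j r - X.selfReading (A, i) A r) := by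
  obtain ⟨a1, a2, ⟨a3, a4⟩, a5⟩ := reading_eq_clock hP hX hl hD hi hj
  obtain ⟨b1, b2, ⟨b3, b4⟩, b5⟩ := reading_eq_clock hP hX hl hD hi hi
  have hself : X.selfReading (A, i) A r = X.reading (A, i) A i r := hX.selfReading_eq _ hi r
  rw [hself, a5, b5]
  set u := X.pulseTime A j r + X.delay (A, j) (A, i) r with hu
  set v := X.pulseTime A i r + X.delay (A, i) (A, i) r with hv
  refine ⟨u - v, abs_le.2 ⟨by linarith, by linarith⟩, ?_⟩
  obtain ⟨r1, r2⟩ := hr i hi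
  rcases le_total v u with h | h
  · obtain ⟨c1, c2⟩ := (hl i hi).clock_bounds b1 h a2.le r1 r2
    have h0 : 0 ≤ u - v := sub_nonneg.2 h
    have hle : u - v ≤ θ * (u - v) := le_mul_of_one_le_left h0 hθ
    rw [max_eq_right hle, min_eq_left hle]
    exact ⟨by linarith, c1⟩
  · obtain ⟨c1, c2⟩ := (hl i hi).clock_bounds a1 h b2.le r1 r2
    have h0 : u - v ≤ 0 := sub_nonpos.2 h
    have hle : θ * (u - v) ≤ u - v := by nlinarith
    rw [max_eq_left hle, min_eq_right hle]
    exact ⟨by linarith, by linarith⟩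

/-- The corrections of round `r`, relative to common reference points. -/
theorem ownDelta_bounds (hP : P.Fits e) (hF : FewFaults P F) (hX : X.IsExecution G F)
    (hl : X.AllListening F A r) (hD : X.SpreadLE F A r D) (hDe : D ≤ e r) (hc : 0 < c)
    (hθ : 1 ≤ θ) (hr : X.RatesIn F A r c θ) :
    ∃ M lo : ℝ, ∀ i, (A, i) ∉ F →
      c * X.pulseTime A i r + X.ownDelta A i r
        ≤ c * ((M + lo + D) / 2 + P.U + (θ - 1) * (D + P.U)) ∧
      c * θ * ((M + lo) / 2 - P.U - (θ - 1) / 2 * D)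
        ≤ c * θ * X.pulseTime A i r + X.ownDelta A i r ∧
      |X.ownDelta A i r| ≤ c * θ * (D + P.U) := by
  have hK := hF.card_correct A
  have hn := hF.n_ge
  obtain ⟨m, hm, hm1, hm2⟩ := exists_median (correct F A) (fun i => X.pulseTime A i r) (f := P.f)
    (by omega)
  obtain ⟨l, hlK, hlmin⟩ := (correct F A).exists_min_image (fun i => X.pulseTime A i r) ⟨m, hm⟩
  have hp : ∀ i ∈ correct F A, X.pulseTime A l r ≤ X.pulseTime A i r ∧
      X.pulseTime A i r ≤ X.pulseTime A l r + D := fun i hi =>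
    ⟨hlmin i hi, by linarith [hD i l (mem_correct.1 hi) (mem_correct.1 hlK)]⟩
  exact ⟨X.pulseTime A m r, X.pulseTime A l r, fun i hi =>
    midpointStat_bounds hn hK hm hm1 hm2 hp (hp i (mem_correct.2 hi)) hc hθ hP.U_nonneg
      fun j hj => readsElapsed hP hX hl (fun a b ha hb => (hD a b ha hb).trans hDe) hi
        (mem_correct.1 hj) hc hθ hr⟩

theorem abs_ownDelta_le (hP : P.Fits e) (hF : FewFaults P F) (hX : X.IsExecution G F)
    (hl : X.AllListening F A r) (hD : X.SpreadLE F A r D) (hDe : D ≤ e r) (hc : 0 < c)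
    (hθ : 1 ≤ θ) (hr : X.RatesIn F A r c θ) (hi : (A, i) ∉ F) :
    |X.ownDelta A i r| ≤ c * θ * (D + P.U) := by
  obtain ⟨M, lo, h⟩ := ownDelta_bounds hP hF hX hl hD hDe hc hθ hr
  exact (h i hi).2.2

/-- How the spread of the pulses changes from one round to the next. -/
theorem spread_succ (hP : P.Fits e) (hF : FewFaults P F) (hX : X.IsExecution G F)
    (hl : X.AllListening F A r) (hD : X.SpreadLE F A r D) (hDe : D ≤ e r) (hc : 0 < c)
    (hθ : 1 ≤ θ) (hr : X.RatesIn F A r c θ) (hr' : X.RatesIn F A (r + 1) c θ)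
    (hf : ∀ i, (A, i) ∉ F → X.Finishing A i r) (hl' : X.AllListening F A (r + 1)) :
    X.SpreadLE F A (r + 1) (D / 2 + 2 * P.U + (θ - 1) * (3 / 2 * D + P.U) +
      (1 - 1 / θ) * ((P.tau2 r + P.tau3 r + P.tau1 (r + 1)) / c)) := by
  obtain ⟨M, lo, h⟩ := ownDelta_bounds hP hF hX hl hD hDe hc hθ hr
  -- From pulse to pulse: phase 2, phase 3 counted as `τ₃ + Δ` at the nominal rate, and phase 1 of
  -- the next round. All three obey the same rate interval.
  have key : ∀ i, (A, i) ∉ F →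
      c * (X.pulseTime A i (r + 1) - X.pulseTime A i r)
        ≤ P.tau2 r + P.tau3 r + P.tau1 (r + 1) + X.ownDelta A i r ∧
      P.tau2 r + P.tau3 r + P.tau1 (r + 1) + X.ownDelta A i r
        ≤ c * θ * (X.pulseTime A i (r + 1) - X.pulseTime A i r) := by
    intro i hi
    have li := hl i hi
    have li' := hl' i hi
    have fi := hf i hi
    obtain ⟨a1, a2⟩ := li.clock_bounds li.start_lt.le li.pulse_lt.le le_rfl
      (hr i hi).1 (hr i hi).2
    obtain ⟨b1, b2⟩ := li'.clock_bounds le_rfl li'.start_lt.le li'.pulse_lt.le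
      (hr' i hi).1 (hr' i hi).2
    rw [li.clock_end] at a1 a2
    rw [li'.clock_pulse] at b1 b2
    have h0 : 0 ≤ X.startTime A i (r + 1) - X.endTime A i r := sub_nonneg.2 fi.end_lt.le
    have c1 := (mul_le_mul_of_nonneg_right (hr i hi).1 h0).trans fi.duration_le
    have c2 := fi.le_duration.trans (mul_le_mul_of_nonneg_right (hr i hi).2 h0)
    constructor <;> linarith
  intro i j hi hj
  exact diameter_step hc hθ (h i hi).1 (h j hj).2.1 (key i hi).1 (key j hj).2

/-- All first rounds begin at time `0`, so only drift during phase 1 separates the first pulses. -/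
theorem spread_zero
    (hl : X.AllListening F A 0) (hc : 0 < c) (hθ : 1 ≤ θ) (hr : X.RatesIn F A 0 c θ) :
    X.SpreadLE F A 0 ((1 - 1 / θ) * (P.tau1 0 / c)) := by
  have key : ∀ i, (A, i) ∉ F → X.pulseTime A i 0 ≤ P.tau1 0 / c ∧
      1 / θ * (P.tau1 0 / c) ≤ X.pulseTime A i 0 := by
    intro i hi
    have li := hl i hi
    have hs : X.startTime A i 0 = 0 := by rw [startTime, start_zero, EReal.toReal_coe]
    obtain ⟨b1, b2⟩ := li.clock_bounds le_rfl li.start_lt.le li.pulse_lt.le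
      (hr i hi).1 (hr i hi).2
    rw [li.clock_pulse, hs, sub_zero] at b1 b2
    have hθ0 : 0 < θ := by linarith
    constructor
    · rw [le_div_iff₀ hc]; linarith
    · rw [div_mul_div_comm, one_mul, div_le_iff₀ (by positivity)]; linarith
  intro i j hi hj
  linarith [(key i hi).1, (key j hj).2]

/-- All correct nodes of a cluster proceed through all rounds, and their pulses stay close. -/
theorem all_rounds (hP : P.Fits e) (hF : FewFaults P F) (hX : X.IsExecution G F) (A : C) (r : ℕ) :
    X.AllListening F A r ∧ X.SpreadLE F A r (e r) ∧ ∀ i, (A, i) ∉ F →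
      X.Finishing A i r ∧ |X.ownDelta A i r| ≤ P.maxRate * (e r + P.U) := by
  have hc : 0 < 1 + P.phi := by linarith [hP.phi_pos]
  have hθ := (one_lt_theta hP.toRegular).le
  have hmax : (1 + P.phi) * P.theta = P.maxRate := by rw [Params.theta, Params.maxRate]; ring
  have hfin : ∀ r, X.AllListening F A r → X.SpreadLE F A r (e r) → ∀ i, (A, i) ∉ F →
      X.Finishing A i r ∧ |X.ownDelta A i r| ≤ P.maxRate * (e r + P.U) := by
    intro r hl hD i hi
    have h := abs_ownDelta_le hP hF hX hl hD le_rfl hc hθ (ratesIn_theta hP.toRegular F X A r) hi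
    rw [hmax] at h
    exact ⟨(hl i hi).finishing hP.toRegular hX hi
      (by linarith [(abs_le.1 h).1, hP.tau3_gt r]), h⟩
  induction r with
  | zero =>
    have hl : X.AllListening F A 0 := fun i hi =>
      listening hP.toRegular hX hi (by rw [start_zero]; exact EReal.coe_ne_top 0)
    have hD : X.SpreadLE F A 0 (e 0) := fun i j hi hj =>
      (spread_zero hl hc hθ (ratesIn_theta hP.toRegular F X A 0) i j hi hj).trans
        hP.init
    exact ⟨hl, hD, hfin 0 hl hD⟩
  | succ r ih =>
    obtain ⟨hl, hD, hf⟩ := ih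
    have hl' : X.AllListening F A (r + 1) := fun i hi =>
      listening hP.toRegular hX hi (by rw [(hf i hi).1.start_eq]; exact EReal.coe_ne_top _)
    have hD' : X.SpreadLE F A (r + 1) (e (r + 1)) := fun i j hi hj =>
      (spread_succ hP hF hX hl hD le_rfl hc hθ (ratesIn_theta hP.toRegular F X A r)
        (ratesIn_theta hP.toRegular F X A (r + 1)) (fun i hi => (hf i hi).1) hl' i j hi hj).trans
        (hP.step r)
    exact ⟨hl', hD', hfin _ hl' hD'⟩

end Trace

/-! ### Clusters whose nodes have the same mode -/

/-- The phases are so long that the corrections are small compared to the speedup: when all nodes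
of a cluster have the same mode, they become smaller still. -/
structure Params.Tuned (P : Params) (e : ℕ → ℝ) : Prop extends P.Fits e where
  d_pos : 0 < P.d
  e_pos : ∀ r, 0 < e r
  same_mode_init : (1 - 1 / (1 + P.rho)) * (P.tau1 0 / (1 + P.phi)) ≤ 1 / 20 * e 0
  same_mode_step : ∀ r q, 0 ≤ q → q ≤ 1 →
    q * e r / 2 + 2 * P.U + (1 + P.rho - 1) * (3 / 2 * (q * e r) + P.U) + (1 - 1 / (1 + P.rho)) *
      ((P.tau2 r + P.tau3 r + P.tau1 (r + 1)) / (1 + P.phi))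
      ≤ (51 / 100 * q + 16 / 1000) * e (r + 1)
  slow_bound : ∀ r, (1 + P.rho) * P.tau3 r
    ≤ (1 + 1 / 4 * P.mu) * (P.tau3 r - P.maxRate * (1 / 20 * e r + P.U))
  fast_bound : ∀ r, (1 + 7 / 8 * P.mu) * (P.tau3 r + P.maxRate * (1 / 20 * e r + P.U))
    ≤ (1 + P.mu) * P.tau3 r
  min_bound : ∀ r, P.maxRate * (e r + P.U) ≤ P.phi * P.tau3 r
  max_bound : ∀ r, P.maxRate * P.tau3 r ≤
    (1 + P.phi) * (1 + 1 / 4 * P.mu) * ((1 + P.phi) * (1 + 7 / 8 * P.mu)) *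
      (P.tau3 r - P.maxRate * (e r + P.U))

namespace Trace

variable {C : Type*} {P : Params} {G : SimpleGraph C} {F : Set (Node C P.n)} {X : Trace C P}
  {A : C} {i j : Fin P.n} {r : ℕ} {e : ℕ → ℝ} {D D' q : ℝ} {g : Bool}

/-- All correct nodes of `A` have mode `g` in round `r`. -/
def SameMode (F : Set (Node C P.n)) (X : Trace C P) (A : C) (r : ℕ) (g : Bool) : Prop :=
  ∀ i, (A, i) ∉ F → X.mode (A, i) r = g

theorem SpreadLE.mono (h : X.SpreadLE F A r D) (hD : D ≤ D') : X.SpreadLE F A r D' :=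
  fun i j hi hj => (h i j hi hj).trans hD

/-- The nominal rate in the mode `g`. -/
def modeRate (P : Params) (g : Bool) : ℝ := (1 + P.phi) * (1 + P.mu * if g then 1 else 0)

theorem nominal_eq_modeRate (h : X.mode (A, i) r = g) : X.nominal A i r = modeRate P g := by
  rw [nominal, modeNum, modeRate, h]

theorem modeRate_bounds (hP : P.Regular) (g : Bool) :
    1 + P.phi ≤ modeRate P g ∧ modeRate P g * (1 + P.rho) ≤ P.maxRate := by
  have h1 := hP.mu_pos
  have h2 := hP.phi_pos
  have h3 := hP.rho_pos
  rw [modeRate, Params.maxRate]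
  have h4 : 0 ≤ (1 + P.phi) * P.mu * (1 + P.rho) := by positivity
  cases g
  · exact ⟨by norm_num, by norm_num; linarith⟩
  · exact ⟨by norm_num; nlinarith, by norm_num⟩

theorem SameMode.ratesIn (h : X.SameMode F A r g) :
    X.RatesIn F A r (modeRate P g) (1 + P.rho) := fun i hi => by
  rw [nominal_eq_modeRate (h i hi)]
  exact ⟨le_rfl, le_rfl⟩

/-- The slow nominal rate is the worse case, so one parameter condition covers both modes. -/
theorem drift_le (hP : P.Regular) (g : Bool) {T : ℝ} (hT : 0 ≤ T) :
    (1 - 1 / (1 + P.rho)) * (T / modeRate P g) ≤ (1 - 1 / (1 + P.rho)) * (T / (1 + P.phi)) := by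
  have h2 := hP.phi_pos
  have h3 := hP.rho_pos
  refine mul_le_mul_of_nonneg_left
    (div_le_div_of_nonneg_left hT (by linarith) (modeRate_bounds hP g).1) ?_
  rw [sub_nonneg, div_le_one (by linarith)]
  linarith

/-- A shared mode cancels in the ratio of the rates, leaving only the hardware drift `1 + ρ` in
place of `P.theta`. -/
theorem SameMode.spread_succ (hP : P.Tuned e) (hF : FewFaults P F) (hX : X.IsExecution G F)
    (h : X.SameMode F A r g) (h' : X.SameMode F A (r + 1) g) (hq0 : 0 ≤ q) (hq1 : q ≤ 1)
    (hD : X.SpreadLE F A r (q * e r)) :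
    X.SpreadLE F A (r + 1) ((51 / 100 * q + 16 / 1000) * e (r + 1)) := by
  obtain ⟨hl, -, hf⟩ := all_rounds hP.toFits hF hX A r
  obtain ⟨hl', -, -⟩ := all_rounds hP.toFits hF hX A (r + 1)
  refine (Trace.spread_succ hP.toFits hF hX hl hD ?_ ?_ ?_ h.ratesIn h'.ratesIn
    (fun i hi => (hf i hi).1) hl').mono (le_trans ?_ (hP.same_mode_step r q hq0 hq1))
  · exact mul_le_of_le_one_left (hP.e_nonneg r) hq1
  · linarith [(modeRate_bounds hP.toRegular g).1, hP.phi_pos]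
  · linarith [hP.rho_pos]
  · have := drift_le hP.toRegular g (T := P.tau2 r + P.tau3 r + P.tau1 (r + 1))
      (by linarith [hP.tau1_pos (r + 1), hP.tau2_pos r, hP.tau3_pos r])
    linarith

theorem SameMode.spread_zero (hP : P.Tuned e) (hF : FewFaults P F) (hX : X.IsExecution G F)
    (h : X.SameMode F A 0 g) : X.SpreadLE F A 0 (1 / 20 * e 0) := by
  obtain ⟨hl, -, -⟩ := all_rounds hP.toFits hF hX A 0
  refine (Trace.spread_zero hl ?_ ?_ h.ratesIn).mono
    ((drift_le hP.toRegular g (hP.tau1_pos 0).le).trans hP.same_mode_init)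
  · linarith [(modeRate_bounds hP.toRegular g).1, hP.phi_pos]
  · linarith [hP.rho_pos]

/-- After a few rounds in the same mode, or if all rounds so far had this mode, the pulses of a
cluster are much closer than in general. -/
theorem spread_of_sameMode (hP : P.Tuned e) (hF : FewFaults P F) (hX : X.IsExecution G F)
    {a R : ℕ} (h : ∀ j, a ≤ j → j ≤ R → X.SameMode F A j g) (haR : a = 0 ∨ a + 6 ≤ R) :
    X.SpreadLE F A R (1 / 20 * e R) := by
  -- The map `q ↦ 0.51 q + 0.016` sends `1/20` to `0.0415`, so this bound persists once reached.
  have keep : ∀ b, a ≤ b → X.SpreadLE F A b (1 / 20 * e b) → ∀ m, b + m ≤ R →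
      X.SpreadLE F A (b + m) (1 / 20 * e (b + m)) := by
    intro b hab hb m
    induction m with
    | zero => intro _; exact hb
    | succ m ih =>
      intro hm
      refine ((h (b + m) (by omega) (by omega)).spread_succ hP hF hX
        (h (b + m + 1) (by omega) (by omega)) (by norm_num) (by norm_num)
        (ih (by omega))).mono ?_
      exact mul_le_mul_of_nonneg_right (by norm_num) (hP.e_nonneg _)
  rcases haR with rfl | haR
  · have := keep 0 le_rfl ((h 0 le_rfl (Nat.zero_le _)).spread_zero hP hF hX) R (by omega)
    rwa [zero_add] at this
  · have h0 : X.SpreadLE F A a (1 * e a) := by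
      rw [one_mul]
      exact (all_rounds hP.toFits hF hX A a).2.1
    have st : ∀ m q, m < 6 → 0 ≤ q → q ≤ 1 → X.SpreadLE F A (a + m) (q * e (a + m)) →
        X.SpreadLE F A (a + (m + 1)) ((51 / 100 * q + 16 / 1000) * e (a + (m + 1))) :=
      fun m q hm hq0 hq1 hD => (h (a + m) (by omega) (by omega)).spread_succ hP hF hX
        (h (a + m + 1) (by omega) (by omega)) hq0 hq1 hD
    -- Starting from `q = 1`, six iterations give about `0.0497 < 1/20`; five give about `0.066`.
    have h1 := st 0 _ (by norm_num) (by norm_num) (by norm_num) h0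
    have h2 := st 1 _ (by norm_num) (by norm_num) (by norm_num) h1
    have h3 := st 2 _ (by norm_num) (by norm_num) (by norm_num) h2
    have h4 := st 3 _ (by norm_num) (by norm_num) (by norm_num) h3
    have h5 := st 4 _ (by norm_num) (by norm_num) (by norm_num) h4
    have h6 := st 5 _ (by norm_num) (by norm_num) (by norm_num) h5
    have := keep (a + 6) (by omega)
      (h6.mono (mul_le_mul_of_nonneg_right (by norm_num) (hP.e_nonneg _))) (R - (a + 6)) (by omega)
    rwa [show a + 6 + (R - (a + 6)) = R by omega] at this

theorem abs_ownDelta_le_of_sameMode (hP : P.Tuned e) (hF : FewFaults P F)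
    (hX : X.IsExecution G F) {a R : ℕ} (h : ∀ j, a ≤ j → j ≤ R → X.SameMode F A j g)
    (haR : a = 0 ∨ a + 6 ≤ R) (hi : (A, i) ∉ F) :
    |X.ownDelta A i R| ≤ P.maxRate * (1 / 20 * e R + P.U) := by
  have hD := spread_of_sameMode hP hF hX h haR
  have hm := modeRate_bounds hP.toRegular g
  have he := hP.e_nonneg R
  refine (abs_ownDelta_le hP.toFits hF hX (all_rounds hP.toFits hF hX A R).1 hD (by linarith)
    (by linarith [hP.phi_pos]) (by linarith [hP.rho_pos])
    (h R (by omega) le_rfl).ratesIn hi).trans ?_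
  exact mul_le_mul_of_nonneg_right hm.2 (by linarith [hP.U_nonneg])

/-! ### Clock rates -/

theorem startTime_zero (X : Trace C P) (A : C) (i : Fin P.n) : X.startTime A i 0 = 0 := by
  rw [startTime, start_zero, EReal.toReal_coe]

theorem start_eq_startTime (hP : P.Tuned e) (hF : FewFaults P F) (hX : X.IsExecution G F)
    (hi : (A, i) ∉ F) (r : ℕ) : X.start (A, i) A r = X.startTime A i r :=
  ((all_rounds hP.toFits hF hX A r).1 i hi).start_eq

theorem startTime_add_lt (hP : P.Tuned e) (hF : FewFaults P F) (hX : X.IsExecution G F)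
    (hi : (A, i) ∉ F) (r : ℕ) : X.startTime A i r + P.d < X.startTime A i (r + 1) := by
  obtain ⟨hl, -, hf⟩ := all_rounds hP.toFits hF hX A r
  have h1 := (hl i hi).start_lt
  have h2 := ((hl i hi).windows hP.toFits).2
  have h3 := (hf i hi).1.end_lt
  linarith [hP.e_nonneg r]

theorem startTime_strictMono (hP : P.Tuned e) (hF : FewFaults P F) (hX : X.IsExecution G F)
    (hi : (A, i) ∉ F) : StrictMono (X.startTime A i) :=
  strictMono_nat_of_lt_succ fun r => by
    linarith [startTime_add_lt hP hF hX hi r, hP.d_pos]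

/-- Rounds cannot accumulate, since each lasts longer than `d`; hence they cover all of `[0, ∞)`. -/
theorem le_startTime (hP : P.Tuned e) (hF : FewFaults P F) (hX : X.IsExecution G F)
    (hi : (A, i) ∉ F) (r : ℕ) : r * P.d ≤ X.startTime A i r := by
  induction r with
  | zero => rw [startTime_zero, Nat.cast_zero, zero_mul]
  | succ r ih =>
    have := startTime_add_lt hP hF hX hi r
    push_cast
    linarith

theorem exists_startTime_gt (hP : P.Tuned e) (hF : FewFaults P F) (hX : X.IsExecution G F)
    (hi : (A, i) ∉ F) (t : ℝ) : ∃ r, t < X.startTime A i (r + 1) := by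
  obtain ⟨r, hr⟩ := exists_nat_gt (t / P.d)
  rw [div_lt_iff₀ hP.d_pos] at hr
  exact ⟨r, hr.trans_le ((le_startTime hP hF hX hi r).trans
    ((startTime_strictMono hP hF hX hi).monotone (Nat.le_succ r)))⟩

theorem exists_round (hP : P.Tuned e) (hF : FewFaults P F) (hX : X.IsExecution G F)
    (hi : (A, i) ∉ F) {t : ℝ} (ht : 0 ≤ t) :
    ∃ r, X.startTime A i r ≤ t ∧ t < X.startTime A i (r + 1) := by
  classical
  have h := exists_startTime_gt hP hF hX hi t
  refine ⟨Nat.find h, ?_, Nat.find_spec h⟩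
  rcases hr : Nat.find h with _ | r
  · rw [startTime_zero]; exact ht
  · exact not_lt.1 (Nat.find_min h (show r < Nat.find h by omega))

/-- No measurability of `corr` or `gam` is assumed; integrability comes from the piecewise form of
the rate in each round. -/
theorem rate_integrable (hP : P.Tuned e) (hF : FewFaults P F) (hX : X.IsExecution G F)
    (hi : (A, i) ∉ F) {t : ℝ} (ht : 0 ≤ t) : IntervalIntegrable (X.rate A i) volume 0 t := by
  obtain ⟨r, hr⟩ := exists_startTime_gt hP hF hX hi t
  refine ((all_rounds hP.toFits hF hX A r).2.2 i hi).1.integrable.mono_set ?_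
  rw [Set.uIcc_of_le ht, Set.uIcc_of_le (ht.trans hr.le)]
  exact Set.Icc_subset_Icc_right hr.le

theorem rate_eq_of_lt_endTime (hP : P.Tuned e) (hF : FewFaults P F) (hX : X.IsExecution G F)
    (hi : (A, i) ∉ F) {s : ℝ} (h1 : X.startTime A i r ≤ s) (h2 : s < X.endTime A i r) :
    X.rate A i s = X.nominal A i r * X.h (A, i) s := by
  have hl := (all_rounds hP.toFits hF hX A r).1 i hi
  refine rate_phase12 hP.toRegular hX hi ?_ ?_
  · rw [hl.start_eq]; exact EReal.coe_le_coe_iff.2 h1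
  · rw [hl.end_eq]; exact EReal.coe_lt_coe_iff.2 h2

theorem tau3_add_ownDelta_pos (hP : P.Tuned e) (hF : FewFaults P F) (hX : X.IsExecution G F)
    (hi : (A, i) ∉ F) (r : ℕ) : 0 < P.tau3 r + X.ownDelta A i r := by
  have := ((all_rounds hP.toFits hF hX A r).2.2 i hi).2
  linarith [(abs_le.1 this).1, hP.tau3_gt r]

theorem rate_eq_of_endTime_le (hP : P.Tuned e) (hF : FewFaults P F) (hX : X.IsExecution G F)
    (hi : (A, i) ∉ F) {s : ℝ} (h1 : X.endTime A i r ≤ s) (h2 : s < X.startTime A i (r + 1)) :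
    X.rate A i s =
      X.nominal A i r * (P.tau3 r / (P.tau3 r + X.ownDelta A i r)) * X.h (A, i) s := by
  obtain ⟨hl, -, hf⟩ := all_rounds hP.toFits hF hX A r
  refine rate_phase3 hP.toRegular hX hi ?_ ?_ (tau3_add_ownDelta_pos hP hF hX hi r)
  · rw [(hl i hi).end_eq]; exact EReal.coe_le_coe_iff.2 h1
  · rw [(hf i hi).1.start_eq]; exact EReal.coe_lt_coe_iff.2 h2

/-- Clock rates are at least `1` and bounded from above. -/
theorem rate_mem (hP : P.Tuned e) (hF : FewFaults P F) (hX : X.IsExecution G F)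
    (hi : (A, i) ∉ F) {s : ℝ} (hs : 0 ≤ s) :
    1 ≤ X.rate A i s ∧ X.rate A i s ≤
      (1 + P.phi) * (1 + 1 / 4 * P.mu) * ((1 + P.phi) * (1 + 7 / 8 * P.mu)) := by
  obtain ⟨r, h1, h2⟩ := exists_round hP hF hX hi hs
  obtain ⟨n1, n2⟩ := X.nominal_bounds hP.toRegular A i r
  have hn := X.nominal_le_maxRate hP.toRegular A i r
  obtain ⟨g1, g2⟩ := hX.h_mem _ hi s
  have hφ := hP.phi_pos
  have hμ := hP.mu_pos
  have hρ := hP.rho_pos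
  have hmax := maxRate_pos hP.toRegular
  have hτ := hP.tau3_pos r
  have hB := hP.max_bound r
  have hmaxh : X.nominal A i r * X.h (A, i) s ≤ P.maxRate :=
    (mul_le_mul_of_nonneg_left g2 (by linarith)).trans hn
  have hminh : 1 + P.phi ≤ X.nominal A i r * X.h (A, i) s := by nlinarith
  set B := (1 + P.phi) * (1 + 1 / 4 * P.mu) * ((1 + P.phi) * (1 + 7 / 8 * P.mu)) with hBdef
  have hB0 : 0 ≤ B := by positivity
  have hw : 0 ≤ P.maxRate * (e r + P.U) :=
    mul_nonneg hmax.le (add_nonneg (hP.e_nonneg r) hP.U_nonneg)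
  rcases lt_or_ge s (X.endTime A i r) with h | h
  · rw [rate_eq_of_lt_endTime hP hF hX hi h1 h]
    refine ⟨by linarith, hmaxh.trans ?_⟩
    refine le_of_mul_le_mul_right (hB.trans ?_) hτ
    exact mul_le_mul_of_nonneg_left (by linarith) hB0
  · rw [rate_eq_of_endTime_le hP hF hX hi h h2]
    have hpos := tau3_add_ownDelta_pos hP hF hX hi r
    obtain ⟨d1, d2⟩ := abs_le.1 ((all_rounds hP.toFits hF hX A r).2.2 i hi).2
    rw [show X.nominal A i r * (P.tau3 r / (P.tau3 r + X.ownDelta A i r)) * X.h (A, i) s =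
      X.nominal A i r * X.h (A, i) s * P.tau3 r / (P.tau3 r + X.ownDelta A i r) by ring,
      le_div_iff₀ hpos, div_le_iff₀ hpos]
    constructor
    -- The largest correction stretches phase 3 by a factor of at most `1 + φ`, which is what the
    -- nominal rate has to spare above `1`.
    · have := mul_le_mul_of_nonneg_right hminh hτ.le
      linarith [hP.min_bound r]
    · refine (mul_le_mul_of_nonneg_right hmaxh hτ.le).trans (hB.trans ?_)
      exact mul_le_mul_of_nonneg_left (by linarith) hB0

/-- When a node has completed phase 2, all others of its cluster have begun the same round. -/
theorem startTime_le_of_endTime_le (hP : P.Tuned e) (hF : FewFaults P F) (hX : X.IsExecution G F)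
    (hi : (A, i) ∉ F) (hj : (A, j) ∉ F) {t : ℝ} (h : X.endTime A i r ≤ t) :
    X.startTime A j r ≤ t := by
  obtain ⟨hl, hD, -⟩ := all_rounds hP.toFits hF hX A r
  have h1 := (hl j hj).start_lt
  have h2 := hD j i hj hi
  have h3 := ((hl i hi).windows hP.toFits).2
  linarith [hP.d_pos]

/-- At time `t`, the correct nodes of `A` have had the mode `g` for `k` rounds. -/
def ModeSettled (F : Set (Node C P.n)) (X : Trace C P) (A : C) (k : ℕ) (t : ℝ) (g : Bool) : Prop :=
  ∀ i, (A, i) ∉ F → ∀ r, X.startTime A i r ≤ t → t < X.startTime A i (r + 1) →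
    ∀ m, r - k ≤ m → m ≤ r → X.mode (A, i) m = g

/-- In phases 1 and 2 the node's own mode decides. In phase 3 the correction depends on the whole
cluster, so the histories of all its nodes must overlap in enough rounds, although at time `t` the
nodes may be in different rounds. -/
theorem rate_bounds_of_modeSettled (hP : P.Tuned e) (hF : FewFaults P F)
    (hX : X.IsExecution G F) {k : ℕ} (hk : 8 ≤ k) {t : ℝ} (ht : 0 ≤ t)
    (h : X.ModeSettled F A k t g) (hi : (A, i) ∉ F) :
    ∀ᶠ s in 𝓝 t, 0 ≤ s →
      (g = false → X.rate A i s ≤ (1 + P.phi) * (1 + 1 / 4 * P.mu)) ∧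
      (g = true → (1 + P.phi) * (1 + 7 / 8 * P.mu) ≤ X.rate A i s) := by
  obtain ⟨r, hr1, hr2⟩ := exists_round hP hF hX hi ht
  have hmono : ∀ j, (A, j) ∉ F → StrictMono (X.startTime A j) :=
    fun j hj => startTime_strictMono hP hF hX hj
  have ev1 : ∀ᶠ s in 𝓝 t, s < X.startTime A i (r + 1) := eventually_lt_nhds hr2
  -- If `t` begins round `r`, nearby times may lie in round `r - 1`, but not earlier.
  have ev2 : ∀ᶠ s in 𝓝 t, r = 0 ∨ X.startTime A i (r - 1) < s := by
    rcases Nat.eq_zero_or_pos r with h0 | h0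
    · exact Eventually.of_forall fun _ => Or.inl h0
    · exact (eventually_gt_nhds ((hmono i hi (Nat.sub_lt h0 one_pos)).trans_le hr1)).mono
        fun _ hs => Or.inr hs
  -- Ensures that if `s` is in phase 3 of its round, phase 2 of that round has ended by time `t`,
  -- where the other nodes are examined.
  have ev3 : ∀ᶠ s in 𝓝 t, t < X.endTime A i r → s < X.endTime A i r := by
    by_cases h0 : t < X.endTime A i r
    · exact (eventually_lt_nhds h0).mono fun _ hs _ => hs
    · exact Eventually.of_forall fun _ h1 => absurd h1 h0
  filter_upwards [ev1, ev2, ev3] with s e1 e2 e3 hs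
  obtain ⟨R, hR1, hR2⟩ := exists_round hP hF hX hi hs
  have hRr : R ≤ r := by
    have := (hmono i hi).lt_iff_lt.1 (hR1.trans_lt e1)
    omega
  have hrR : r ≤ R + 1 := by
    rcases e2 with e2 | e2
    · omega
    · have := (hmono i hi).lt_iff_lt.1 (e2.trans hR2)
      omega
  have hmode : X.mode (A, i) R = g := h i hi r hr1 hr2 R (by omega) hRr
  obtain ⟨g1, g2⟩ := hX.h_mem _ hi s
  have hφ := hP.phi_pos
  have hμ := hP.mu_pos
  have hρ := hP.rho_pos
  have hmax := maxRate_pos hP.toRegular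
  have hτ := hP.tau3_pos R
  have hW : 0 ≤ P.maxRate * (1 / 20 * e R + P.U) :=
    mul_nonneg hmax.le (by linarith [hP.e_nonneg R, hP.U_nonneg])
  have hslow := hP.slow_bound R
  have hfast := hP.fast_bound R
  rcases lt_or_ge s (X.endTime A i R) with hend | hend
  · rw [rate_eq_of_lt_endTime hP hF hX hi hR1 hend, nominal_eq_modeRate hmode, modeRate]
    refine ⟨?_, ?_⟩ <;> rintro rfl
    · have h1 : 1 + P.rho ≤ 1 + 1 / 4 * P.mu := by
        refine le_of_mul_le_mul_right (hslow.trans ?_) hτ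
        exact mul_le_mul_of_nonneg_left (by linarith) (by positivity)
      simp only [Bool.false_eq_true, if_false, mul_zero, add_zero, mul_one]
      exact mul_le_mul_of_nonneg_left (g2.trans h1) (by linarith)
    · simp only [if_true, mul_one]
      rw [mul_assoc]
      refine mul_le_mul_of_nonneg_left ?_ (by linarith)
      nlinarith
  · have hendt : X.endTime A i R ≤ t := by
      by_contra! hlt
      rcases hRr.eq_or_lt with rfl | hlt'
      · exact absurd (e3 hlt) (not_lt.2 hend)
      · have h1 : R + 1 = r := by omega
        have h2 := ((all_rounds hP.toFits hF hX A R).2.2 i hi).1.end_lt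
        rw [h1] at h2
        linarith
    -- At time `t` the other nodes are in rounds `R` to `R + 2`, so the common history begins no
    -- later than round `R + 2 - k`. As `8 ≤ k`, this is at most `R - 6`, unless truncated
    -- subtraction makes it round `0`.
    have hall : ∀ m, R + 2 - k ≤ m → m ≤ R → X.SameMode F A m g := by
      intro m hm1 hm2 j hj
      obtain ⟨rj, hj1, hj2⟩ := exists_round hP hF hX hj ht
      have hRj : R ≤ rj := by
        have := (hmono j hj).lt_iff_lt.1
          ((startTime_le_of_endTime_le hP hF hX hi hj hendt).trans_lt hj2)
        omega
      -- Beyond that, `j` would have finished phase 2 of round `R + 2`, so `i` would have begun that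
      -- round by time `t`, against `r ≤ R + 1`.
      have hjR : rj ≤ R + 2 := by
        by_contra! hlt
        have h1 := ((all_rounds hP.toFits hF hX A (R + 2)).2.2 j hj).1.end_lt
        have h2 := (hmono j hj).monotone (show R + 2 + 1 ≤ rj by omega)
        have h3 := startTime_le_of_endTime_le hP hF hX hj hi (h1.le.trans (h2.trans hj1))
        have := (hmono i hi).lt_iff_lt.1 (h3.trans_lt hr2)
        omega
      exact h j hj rj hj1 hj2 m (by omega) (by omega)
    obtain ⟨d1, d2⟩ := abs_le.1 (abs_ownDelta_le_of_sameMode hP hF hX hall (by omega) hi)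
    have hpos := tau3_add_ownDelta_pos hP hF hX hi R
    rw [rate_eq_of_endTime_le hP hF hX hi hend hR2, nominal_eq_modeRate hmode, modeRate]
    refine ⟨?_, ?_⟩ <;> rintro rfl
    · simp only [Bool.false_eq_true, if_false, mul_zero, add_zero, mul_one]
      rw [mul_assoc]
      refine mul_le_mul_of_nonneg_left ?_ (by linarith)
      rw [div_mul_eq_mul_div, div_le_iff₀ hpos]
      have h1 : P.tau3 R * X.h (A, i) s ≤ (1 + P.rho) * P.tau3 R := by
        rw [mul_comm]
        exact mul_le_mul_of_nonneg_right g2 hτ.le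
      refine h1.trans (hslow.trans ?_)
      exact mul_le_mul_of_nonneg_left (by linarith) (by positivity)
    · simp only [if_true, mul_one]
      rw [mul_assoc, mul_assoc]
      refine mul_le_mul_of_nonneg_left ?_ (by linarith)
      rw [div_mul_eq_mul_div (P.tau3 R), mul_div_assoc' (1 + P.mu), le_div_iff₀ hpos]
      have h1 : (1 + P.mu) * P.tau3 R ≤ (1 + P.mu) * (P.tau3 R * X.h (A, i) s) :=
        mul_le_mul_of_nonneg_left (le_mul_of_one_le_right hτ.le g1) (by linarith)
      refine le_trans ?_ (hfast.trans h1)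
      exact mul_le_mul_of_nonneg_left (by linarith) (by positivity)

end Trace

/-! ### From clock rates to derivative numbers of the cluster clock -/

/-- Increments, unlike difference quotients of single clocks, pass directly to the maximum and
minimum of finitely many clocks. The restriction `0 ≤ s` makes the statement one-sided at `t = 0`.
-/
theorem eventually_increment_le {f L : ℝ → ℝ} (hL : ∀ t, L t = ∫ s in (0 : ℝ)..t, f s)
    (hf : ∀ t, 0 ≤ t → IntervalIntegrable f volume 0 t) {t b : ℝ} (ht : 0 ≤ t)
    (h : ∀ᶠ s in 𝓝 t, 0 ≤ s → f s ≤ b) :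
    ∀ᶠ s in 𝓝 t, 0 ≤ s → (t ≤ s → L s - L t ≤ b * (s - t)) ∧ (s ≤ t → L t - L s ≤ b * (t - s)) := by
  obtain ⟨ε, hε, hball⟩ := Metric.eventually_nhds_iff.1 h
  have key : ∀ u v, 0 ≤ u → u ≤ v → |u - t| < ε → |v - t| < ε → L v - L u ≤ b * (v - u) := by
    intro u v hu huv hut hvt
    rw [hL v, hL u, intervalIntegral.integral_interval_sub_left (hf v (hu.trans huv)) (hf u hu)]
    have hconst : ∫ _ in u..v, b = b * (v - u) := by
      rw [intervalIntegral.integral_const, smul_eq_mul, mul_comm]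
    rw [← hconst]
    refine intervalIntegral.integral_mono_on huv ((hf u hu).symm.trans (hf v (hu.trans huv)))
      (by simp) fun s hs => hball ?_ (hu.trans hs.1)
    rw [Real.dist_eq, abs_lt]
    exact ⟨by linarith [(abs_lt.1 hut).1, hs.1], by linarith [(abs_lt.1 hvt).2, hs.2]⟩
  have h0 : |t - t| < ε := by simpa using hε
  refine Metric.eventually_nhds_iff.2 ⟨ε, hε, fun s hs hs0 => ?_⟩
  rw [Real.dist_eq] at hs
  exact ⟨fun hts => key t s ht hts h0 hs, fun hst => key s t hs0 hst hs h0⟩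

theorem eventually_le_increment {f L : ℝ → ℝ} (hL : ∀ t, L t = ∫ s in (0 : ℝ)..t, f s)
    (hf : ∀ t, 0 ≤ t → IntervalIntegrable f volume 0 t) {t b : ℝ} (ht : 0 ≤ t)
    (h : ∀ᶠ s in 𝓝 t, 0 ≤ s → b ≤ f s) :
    ∀ᶠ s in 𝓝 t, 0 ≤ s → (t ≤ s → b * (s - t) ≤ L s - L t) ∧ (s ≤ t → b * (t - s) ≤ L t - L s) := by
  have := eventually_increment_le (f := fun s => -f s) (L := fun s => -L s)
    (fun t => by rw [hL, intervalIntegral.integral_neg]) (fun t ht => (hf t ht).neg) ht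
    (b := -b) (h.mono fun s hs h0 => neg_le_neg (hs h0))
  refine this.mono fun s hs h0 => ⟨fun h1 => ?_, fun h1 => ?_⟩
  · linarith [(hs h0).1 h1]
  · linarith [(hs h0).2 h1]

theorem rateAtMost_of_increment {L : ℝ → ℝ} {t b : ℝ}
    (h : ∀ᶠ s in 𝓝 t, 0 ≤ s →
      (t ≤ s → L s - L t ≤ b * (s - t)) ∧ (s ≤ t → L t - L s ≤ b * (t - s))) :
    RateAtMost L t b := by
  intro b' hb'
  filter_upwards [nhdsWithin_le_nhds h, self_mem_nhdsWithin] with s hs hmem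
  refine lt_of_le_of_lt ?_ hb'
  rcases lt_or_gt_of_ne hmem.2 with hlt | hgt
  · rw [div_le_iff_of_neg (by linarith)]
    linarith [(hs hmem.1).2 hlt.le]
  · rw [div_le_iff₀ (sub_pos.2 hgt)]
    exact (hs hmem.1).1 (le_of_lt hgt)

theorem rateAtLeast_of_increment {L : ℝ → ℝ} {t b : ℝ}
    (h : ∀ᶠ s in 𝓝 t, 0 ≤ s →
      (t ≤ s → b * (s - t) ≤ L s - L t) ∧ (s ≤ t → b * (t - s) ≤ L t - L s)) :
    RateAtLeast L t b := by
  intro b' hb'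
  filter_upwards [nhdsWithin_le_nhds h, self_mem_nhdsWithin] with s hs hmem
  refine lt_of_lt_of_le hb' ?_
  rcases lt_or_gt_of_ne hmem.2 with hlt | hgt
  · rw [le_div_iff_of_neg (by linarith)]
    linarith [(hs hmem.1).2 hlt.le]
  · rw [le_div_iff₀ (sub_pos.2 hgt)]
    exact (hs hmem.1).1 (le_of_lt hgt)

namespace Trace

variable {C : Type*} {P : Params} {G : SimpleGraph C} {F : Set (Node C P.n)} {X : Trace C P}
  {A : C} {i : Fin P.n} {e : ℕ → ℝ}

/-- If all correct clocks advance by at most `c`, so does the cluster clock. -/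
theorem clusterClock_le_add (hF : FewFaults P F) {s t c : ℝ}
    (h : ∀ i, (A, i) ∉ F → X.L (A, i) t ≤ X.L (A, i) s + c) :
    X.clusterClock F A t ≤ X.clusterClock F A s + c := by
  obtain ⟨i₀, hi₀⟩ := hF.exists_correct A
  have hfin : ∀ u, {x | ∃ i : Fin P.n, (A, i) ∉ F ∧ x = X.L (A, i) u}.Finite := fun u =>
    (Set.finite_range fun i => X.L (A, i) u).subset fun x ⟨i, _, hx⟩ => ⟨i, hx.symm⟩
  have hne : ∀ u, {x | ∃ i : Fin P.n, (A, i) ∉ F ∧ x = X.L (A, i) u}.Nonempty := fun u =>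
    ⟨_, i₀, hi₀, rfl⟩
  have h1 : sSup {x | ∃ i : Fin P.n, (A, i) ∉ F ∧ x = X.L (A, i) t} ≤
      sSup {x | ∃ i : Fin P.n, (A, i) ∉ F ∧ x = X.L (A, i) s} + c := by
    refine csSup_le (hne t) ?_
    rintro _ ⟨i, hi, rfl⟩
    have := le_csSup (hfin s).bddAbove ⟨i, hi, rfl⟩
    linarith [h i hi]
  have h2 : sInf {x | ∃ i : Fin P.n, (A, i) ∉ F ∧ x = X.L (A, i) t} - c ≤
      sInf {x | ∃ i : Fin P.n, (A, i) ∉ F ∧ x = X.L (A, i) s} := by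
    refine le_csInf (hne s) ?_
    rintro _ ⟨i, hi, rfl⟩
    have := csInf_le (hfin t).bddBelow ⟨i, hi, rfl⟩
    linarith [h i hi]
  rw [clusterClock, clusterClock]
  linarith

theorem rateAtMost_clusterClock (hP : P.Tuned e) (hF : FewFaults P F) (hX : X.IsExecution G F)
    {t b : ℝ} (ht : 0 ≤ t)
    (h : ∀ i, (A, i) ∉ F → ∀ᶠ s in 𝓝 t, 0 ≤ s → X.rate A i s ≤ b) :
    RateAtMost (X.clusterClock F A) t b := by
  have hall := eventually_all.2 fun i => eventually_all.2 fun hi : (A, i) ∉ F =>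
    eventually_increment_le (L := X.L (A, i)) (X.clock_eq A i)
      (fun _ => rate_integrable hP hF hX hi) ht (h i hi)
  refine rateAtMost_of_increment (hall.mono fun s hs h0 => ⟨fun hts => ?_, fun hst => ?_⟩)
  · rw [sub_le_iff_le_add']
    exact clusterClock_le_add hF fun i hi => by linarith [(hs i hi h0).1 hts]
  · rw [sub_le_iff_le_add']
    exact clusterClock_le_add hF fun i hi => by linarith [(hs i hi h0).2 hst]

theorem rateAtLeast_clusterClock (hP : P.Tuned e) (hF : FewFaults P F) (hX : X.IsExecution G F)
    {t b : ℝ} (ht : 0 ≤ t)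
    (h : ∀ i, (A, i) ∉ F → ∀ᶠ s in 𝓝 t, 0 ≤ s → b ≤ X.rate A i s) :
    RateAtLeast (X.clusterClock F A) t b := by
  have hall := eventually_all.2 fun i => eventually_all.2 fun hi : (A, i) ∉ F =>
    eventually_le_increment (L := X.L (A, i)) (X.clock_eq A i)
      (fun _ => rate_integrable hP hF hX hi) ht (h i hi)
  refine rateAtLeast_of_increment (hall.mono fun s hs h0 => ⟨fun hts => ?_, fun hst => ?_⟩)
  -- The increment may be negative: a lower bound on the advance from `t` to `s` is an upper bound
  -- on the change from `s` back to `t`.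
  · have := clusterClock_le_add (X := X) (A := A) (s := s) (t := t) (c := -(b * (s - t))) hF
      fun i hi => by linarith [(hs i hi h0).1 hts]
    linarith
  · have := clusterClock_le_add (X := X) (A := A) (s := t) (t := s) (c := -(b * (t - s))) hF
      fun i hi => by linarith [(hs i hi h0).2 hst]
    linarith

theorem clusterClock_zero (hF : FewFaults P F) (X : Trace C P) (A : C) :
    X.clusterClock F A 0 = 0 := by
  obtain ⟨i₀, hi₀⟩ := hF.exists_correct A
  have h0 : ∀ i, X.L (A, i) 0 = 0 := fun i => intervalIntegral.integral_same
  have : {x | ∃ i : Fin P.n, (A, i) ∉ F ∧ x = X.L (A, i) 0} = {0} := by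
    ext x
    simp only [h0, Set.mem_ofPred_eq, Set.mem_singleton_iff]
    exact ⟨fun ⟨_, _, hx⟩ => hx, fun hx => ⟨i₀, hi₀, hx⟩⟩
  rw [clusterClock, this, csSup_singleton, csInf_singleton, add_zero, zero_div]

/-! ### Triggers and modes -/

/-- The fast trigger has priority in the algorithm, so the slow one must exclude it. With levels `s`
(fast) and `s'` (slow), the neighbour ahead forces `s < s'` and the one behind forces `s' < s + 1`.
-/
theorem not_fastTrigger_of_slowTrigger (hκ : 2 * P.delta < P.kappa) (hδ : 0 ≤ P.delta)
    {v : Node C P.n} {t : ℝ} (h : X.SlowTrigger G v t) : ¬ X.FastTrigger G v t := by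
  rintro ⟨s, -, ⟨B, hB, hB1⟩, hB2⟩
  obtain ⟨s', -, ⟨B', hB', hB1'⟩, hB2'⟩ := h
  have h1 := hB2' B hB
  have h2 := hB2 B' hB'
  have hκ0 : 0 < P.kappa := by linarith
  have h3 : (2 * (s : ℝ)) < 2 * s' := by
    by_contra! hle
    nlinarith
  have h4 : (s : ℝ) + 1 ≤ s' := by
    have : s < s' := by exact_mod_cast (by linarith : (s : ℝ) < s')
    exact_mod_cast this
  nlinarith

/-- Faithfulness is silent at `t = 0`; there all cluster clocks agree, so no condition requiring a
positive difference can hold. -/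
theorem not_fastCondition_zero (hF : FewFaults P F) (X : Trace C P) (A : C) {κ : ℝ} (hκ : 0 < κ) :
    ¬ FastCondition G κ (X.clusterClock F) A 0 := by
  rintro ⟨s, hs, ⟨B, -, hB⟩, -⟩
  rw [clusterClock_zero hF, clusterClock_zero hF] at hB
  have : (1 : ℝ) ≤ s := by exact_mod_cast hs
  nlinarith

theorem not_slowCondition_zero (hF : FewFaults P F) (X : Trace C P) (A : C) {κ : ℝ} (hκ : 0 < κ) :
    ¬ SlowCondition G κ (X.clusterClock F) A 0 := by
  rintro ⟨s, hs, ⟨B, -, hB⟩, -⟩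
  rw [clusterClock_zero hF, clusterClock_zero hF] at hB
  have : (1 : ℝ) ≤ s := by exact_mod_cast hs
  nlinarith

theorem isGreatest_round (hP : P.Tuned e) (hF : FewFaults P F) (hX : X.IsExecution G F)
    (hi : (A, i) ∉ F) {t : ℝ} {r : ℕ} (h1 : X.startTime A i r ≤ t)
    (h2 : t < X.startTime A i (r + 1)) :
    IsGreatest {j : ℕ | X.start (A, i) A j ≤ t} r := by
  refine ⟨?_, fun j hj => ?_⟩
  · rw [Set.mem_ofPred_eq, start_eq_startTime hP hF hX hi]
    exact EReal.coe_le_coe_iff.2 h1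
  · rw [Set.mem_ofPred_eq, start_eq_startTime hP hF hX hi, EReal.coe_le_coe_iff] at hj
    have := (startTime_strictMono hP hF hX hi).lt_iff_lt.1 (hj.trans_lt h2)
    omega

theorem modeSettled_of_fastCondition (hP : P.Tuned e) (hF : FewFaults P F)
    (hX : X.IsExecution G F) {k : ℕ} (hk : X.IsFaithful G F k) {t : ℝ} (ht : 0 < t)
    (h : FastCondition G P.kappa (X.clusterClock F) A t) : X.ModeSettled F A k t true := by
  intro i hi r hr1 hr2 m hm1 hm2
  have hmono := (startTime_strictMono hP hF hX hi).monotone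
  refine (hX.intercluster _ hi).fast m _ (start_eq_startTime hP hF hX hi m) ?_
  refine (hk _ hi t ht r (isGreatest_round hP hF hX hi hr1 hr2)).1 h _ ?_ ?_
  · rw [start_eq_startTime hP hF hX hi]
    exact EReal.coe_le_coe_iff.2 (hmono hm1)
  · rw [start_eq_startTime hP hF hX hi]
    exact EReal.coe_le_coe_iff.2 (hmono hm2)

theorem modeSettled_of_slowCondition (hP : P.Tuned e) (hF : FewFaults P F)
    (hX : X.IsExecution G F) (hκ : 2 * P.delta < P.kappa) (hδ : 0 ≤ P.delta) {k : ℕ}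
    (hk : X.IsFaithful G F k) {t : ℝ} (ht : 0 < t)
    (h : SlowCondition G P.kappa (X.clusterClock F) A t) : X.ModeSettled F A k t false := by
  intro i hi r hr1 hr2 m hm1 hm2
  have hmono := (startTime_strictMono hP hF hX hi).monotone
  have hST : X.SlowTrigger G (A, i) (X.startTime A i m) := by
    refine (hk _ hi t ht r (isGreatest_round hP hF hX hi hr1 hr2)).2 h _ ?_ ?_
    · rw [start_eq_startTime hP hF hX hi]
      exact EReal.coe_le_coe_iff.2 (hmono hm1)
    · rw [start_eq_startTime hP hF hX hi]
      exact EReal.coe_le_coe_iff.2 (hmono hm2)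
  exact (hX.intercluster _ hi).slow m _ (start_eq_startTime hP hF hX hi m)
    (not_fastTrigger_of_slowTrigger hκ hδ hST) hST

/-- In faithful executions with well-chosen phase lengths, the cluster clocks satisfy the axioms. -/
theorem gcsAxioms_clusterClock (hP : P.Tuned e) (hF : FewFaults P F) (hX : X.IsExecution G F)
    (hκ : 2 * P.delta < P.kappa) (hδ : 0 ≤ P.delta) {k : ℕ} (hk8 : 8 ≤ k)
    (hk : X.IsFaithful G F k) :
    GCSAxioms G P.kappa ((1 + P.phi) * (1 + 1 / 4 * P.mu) - 1)
      ((1 + P.phi) * (1 + 7 / 8 * P.mu) - 1) (X.clusterClock F) := by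
  have hφ := hP.phi_pos
  have hμ := hP.mu_pos
  have hκ0 : 0 < P.kappa := by linarith
  have hrho : 0 < (1 + P.phi) * (1 + 1 / 4 * P.mu) - 1 := by
    have : 0 < P.phi * P.mu := mul_pos hφ hμ
    linarith
  have hmu : (1 + P.phi) * (1 + 1 / 4 * P.mu) - 1 < (1 + P.phi) * (1 + 7 / 8 * P.mu) - 1 := by
    have : 0 < P.phi * P.mu := mul_pos hφ hμ
    linarith
  refine ⟨hrho, hrho.trans hmu, fun A t ht => ⟨?_, ?_⟩, fun A t ht h => ?_, fun A t ht h => ?_, ?_⟩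
  · exact rateAtLeast_clusterClock hP hF hX ht fun i hi =>
      Eventually.of_forall fun s hs => (rate_mem hP hF hX hi hs).1
  · rw [add_sub_cancel, add_sub_cancel]
    exact rateAtMost_clusterClock hP hF hX ht fun i hi =>
      Eventually.of_forall fun s hs => (rate_mem hP hF hX hi hs).2
  · rcases (show (0 : ℝ) ≤ t from ht).eq_or_lt with rfl | ht0
    · exact absurd h (not_slowCondition_zero hF X A hκ0)
    · have hm := modeSettled_of_slowCondition hP hF hX hκ hδ hk ht0 h
      rw [add_sub_cancel]
      exact rateAtMost_clusterClock hP hF hX ht fun i hi =>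
        (rate_bounds_of_modeSettled hP hF hX hk8 ht hm hi).mono fun s hs h0 => (hs h0).1 rfl
  · rcases (show (0 : ℝ) ≤ t from ht).eq_or_lt with rfl | ht0
    · exact absurd h (not_fastCondition_zero hF X A hκ0)
    · have hm := modeSettled_of_fastCondition hP hF hX hk ht0 h
      rw [add_sub_cancel]
      exact rateAtLeast_clusterClock hP hF hX ht fun i hi =>
        (rate_bounds_of_modeSettled hP hF hX hk8 ht hm hi).mono fun s hs h0 => (hs h0).2 rfl
  · rw [one_lt_div hrho]
    exact hmu

end Trace

/-! ### The choice of parameters -/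

/-- The assumptions on the model parameters, with a small hardware clock drift. -/
structure SmallDrift (c2 rho d U e0 : ℝ) : Prop where
  c2_ge : 32 ≤ c2
  rho_pos : 0 < rho
  mu_le : muOf c2 rho ≤ 1 / 1000000
  d_pos : 0 < d
  U_nonneg : 0 ≤ U
  U_le : U ≤ d
  e0_ge : steadyError c2 rho d U ≤ e0

namespace SmallDrift

variable {c2 rho d U e0 : ℝ}

/-! ### Sizes of the derived constants for small drift. -/

theorem rho_le_mu (h : SmallDrift c2 rho d U e0) : 32 * rho ≤ muOf c2 rho :=
  mul_le_mul_of_nonneg_right h.c2_ge h.rho_pos.le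

theorem mu_pos (h : SmallDrift c2 rho d U e0) : 0 < muOf c2 rho := by
  linarith [h.rho_le_mu, h.rho_pos]

/-- The defining property of `c₁`: with mixed modes, the drift over phase 3 costs just under half of
the error bound. -/
theorem c1_mul (h : SmallDrift c2 rho d U e0) : c1 c2 rho * (rho + muOf c2 rho) = 2047 / 4096 := by
  have h1 := h.rho_pos
  have h2 : 0 < 1 + c2 := by linarith [h.c2_ge]
  rw [c1, muOf]
  field_simp
  ring

theorem c1_pos (h : SmallDrift c2 rho d U e0) : 0 < c1 c2 rho := by
  have h1 : 0 < c1 c2 rho * (rho + muOf c2 rho) := by rw [h.c1_mul]; norm_num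
  exact pos_of_mul_pos_left h1 (by linarith [h.mu_pos, h.rho_pos])

theorem c1_mul_phi (h : SmallDrift c2 rho d U e0) : c1 c2 rho * phiOf c2 rho = 1 :=
  mul_one_div_cancel h.c1_pos.ne'

theorem phi_pos (h : SmallDrift c2 rho d U e0) : 0 < phiOf c2 rho :=
  one_div_pos.2 h.c1_pos

theorem phi_mul (h : SmallDrift c2 rho d U e0) :
    2047 / 4096 * phiOf c2 rho = rho + muOf c2 rho := by
  rw [← h.c1_mul, mul_right_comm, h.c1_mul_phi, one_mul]

theorem c1_mul_rho_le (h : SmallDrift c2 rho d U e0) :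
    33 * (c1 c2 rho * rho) ≤ 2047 / 4096 := by
  rw [← h.c1_mul]
  nlinarith [h.rho_le_mu, h.c1_pos]

theorem one_lt_c1 (h : SmallDrift c2 rho d U e0) : 1 < c1 c2 rho := by
  have h1 := h.c1_mul
  have h2 := h.mu_le
  have h3 := h.rho_le_mu
  have h4 := h.c1_pos
  have h5 := h.rho_pos
  by_contra! h6
  nlinarith

theorem thetaG_eq (c2 rho : ℝ) : thetaG c2 rho = 1 + (rho + muOf c2 rho + rho * muOf c2 rho) := by
  rw [thetaG]; ring

theorem one_lt_thetaG (h : SmallDrift c2 rho d U e0) : 1 < thetaG c2 rho := by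
  have := h.mu_pos
  have := h.rho_pos
  rw [thetaG_eq]
  have : 0 < rho * muOf c2 rho := by positivity
  linarith

theorem thetaG_le (h : SmallDrift c2 rho d U e0) : thetaG c2 rho ≤ 1 + 11 / 10 * muOf c2 rho := by
  have h1 := h.mu_pos
  have h2 := h.rho_pos
  have h3 := h.rho_le_mu
  have h4 := h.mu_le
  rw [thetaG_eq]
  nlinarith

theorem gammaG_eq (h : SmallDrift c2 rho d U e0) :
    gammaG c2 rho = (1 + muOf c2 rho) * (thetaG c2 rho - 1) := by
  have h1 : 1 + phiOf c2 rho ≠ 0 := by linarith [h.phi_pos]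
  have h2 : thetaG c2 rho ≠ 0 := by linarith [h.one_lt_thetaG]
  rw [gammaG, zetaMax, div_self h2, mul_one, mul_div_cancel_left₀ _ h1]

theorem gammaG_bounds (h : SmallDrift c2 rho d U e0) :
    0 < gammaG c2 rho ∧ gammaG c2 rho ≤ 1 / 500000 := by
  have h1 := h.mu_pos
  have h2 := h.one_lt_thetaG
  have h3 := h.thetaG_le
  have h4 := h.mu_le
  rw [h.gammaG_eq]
  refine ⟨mul_pos (by linarith) (by linarith), ?_⟩
  nlinarith

theorem gammaG_mul_c1 (h : SmallDrift c2 rho d U e0) :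
    2047 / 4096 ≤ gammaG c2 rho * c1 c2 rho ∧
      gammaG c2 rho * c1 c2 rho ≤ 2047 / 4096 + 1 / 500000 := by
  have h1 := h.c1_mul
  have h2 := h.c1_mul_rho_le
  have h3 := h.mu_pos
  have h4 := h.mu_le
  have h5 := h.c1_pos
  have h6 := h.rho_pos
  have e1 : gammaG c2 rho * c1 c2 rho = (1 + muOf c2 rho) *
      (c1 c2 rho * (rho + muOf c2 rho) + c1 c2 rho * rho * muOf c2 rho) := by
    rw [h.gammaG_eq, thetaG_eq]; ring
  rw [e1, h1]
  have h7 : 0 < c1 c2 rho * rho := by positivity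
  constructor
  · nlinarith [mul_pos h7 h3]
  · nlinarith [mul_pos h7 h3]

/-- The contribution of the midpoint rule to the contraction factor. -/
theorem midpoint_factor_bounds (h : SmallDrift c2 rho d U e0) :
    1 / 2 + 3 / 2 * (thetaG c2 rho - 1)
      ≤ (2 * thetaG c2 rho ^ 2 + 5 * thetaG c2 rho - 5) / (2 * (thetaG c2 rho + 1)) ∧
    (2 * thetaG c2 rho ^ 2 + 5 * thetaG c2 rho - 5) / (2 * (thetaG c2 rho + 1))
      ≤ 1 / 2 + 2 * (thetaG c2 rho - 1) := by
  have h1 := h.one_lt_thetaG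
  have h2 := h.thetaG_le
  have h3 := h.mu_le
  constructor
  · rw [le_div_iff₀ (by linarith)]
    nlinarith
  · rw [div_le_iff₀ (by linarith)]
    nlinarith

/-! ### The contraction factor and the steady state error. -/

theorem alphaG_mul (h : SmallDrift c2 rho d U e0) :
    (1 - gammaG c2 rho) * alphaG c2 rho =
      (2 * thetaG c2 rho ^ 2 + 5 * thetaG c2 rho - 5) / (2 * (thetaG c2 rho + 1)) +
        gammaG c2 rho + gammaG c2 rho * c1 c2 rho := by
  have h1 : 1 - gammaG c2 rho ≠ 0 := by linarith [h.gammaG_bounds.2]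
  have h2 : thetaG c2 rho + 1 ≠ 0 := by linarith [h.one_lt_thetaG]
  rw [alphaG]
  field_simp
  ring

theorem betaG_mul (h : SmallDrift c2 rho d U e0) :
    (1 - gammaG c2 rho) * betaG c2 rho d U =
      gammaG c2 rho * d + (3 * thetaG c2 rho - 1 + gammaG c2 rho * c1 c2 rho) * U := by
  have h1 : 1 - gammaG c2 rho ≠ 0 := by linarith [h.gammaG_bounds.2]
  rw [betaG]
  field_simp

/-- The midpoint rule contributes slightly more than `1/2`, the drift `γ c₁` slightly more than `1/2
- 1/4096`; the excess is of order `10⁻⁶`, less than `1/4096`. The lower bound matters too: it makes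
the steady error at least `4096 β`, far above `U` and `ρ d`. -/
theorem alphaG_bounds (h : SmallDrift c2 rho d U e0) :
    1 - 1 / 4096 ≤ alphaG c2 rho ∧ alphaG c2 rho < 1 := by
  have h0 := h.alphaG_mul
  obtain ⟨g1, g2⟩ := h.gammaG_bounds
  obtain ⟨k1, k2⟩ := h.midpoint_factor_bounds
  obtain ⟨c1', c2'⟩ := h.gammaG_mul_c1
  have h1 := h.one_lt_thetaG
  have h2 := h.thetaG_le
  have h3 := h.mu_le
  constructor
  · by_contra! hlt
    nlinarith
  · by_contra! hge
    nlinarith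

theorem betaG_ge (h : SmallDrift c2 rho d U e0) :
    2 * U ≤ betaG c2 rho d U ∧ 33 * (rho * d) ≤ betaG c2 rho d U := by
  have h0 := h.betaG_mul
  obtain ⟨g1, g2⟩ := h.gammaG_bounds
  have h1 := h.one_lt_thetaG
  have h2 := h.U_nonneg
  have h3 := h.d_pos
  have h4 := h.gammaG_mul_c1.1
  have h5 : 33 * rho ≤ gammaG c2 rho := by
    have := h.mu_pos
    have := h.rho_le_mu
    have := h.rho_pos
    rw [h.gammaG_eq, thetaG_eq]
    nlinarith [mul_pos h.rho_pos h.mu_pos]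
  have hγd : 33 * (rho * d) ≤ gammaG c2 rho * d := by nlinarith
  have hρd : 0 < rho * d := mul_pos h.rho_pos h3
  have hU : 2 * U ≤ (3 * thetaG c2 rho - 1 + gammaG c2 rho * c1 c2 rho) * U := by nlinarith
  have hβ : 0 < betaG c2 rho d U :=
    pos_of_mul_pos_right (b := betaG c2 rho d U) (by rw [h0]; linarith)
      (by linarith : 0 ≤ 1 - gammaG c2 rho)
  have hγβ : 0 ≤ gammaG c2 rho * betaG c2 rho d U := by positivity
  constructor <;> linarith

theorem steadyError_mul (h : SmallDrift c2 rho d U e0) :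
    (1 - alphaG c2 rho) * steadyError c2 rho d U = betaG c2 rho d U := by
  have : 1 - alphaG c2 rho ≠ 0 := by linarith [h.alphaG_bounds.2]
  rw [steadyError, mul_div_cancel₀ _ this]

theorem steadyError_le_errorBound (h : SmallDrift c2 rho d U e0) (r : ℕ) :
    steadyError c2 rho d U ≤ errorBound c2 rho d U e0 r := by
  induction r with
  | zero => exact h.e0_ge
  | succ r ih =>
    have h1 := h.steadyError_mul
    have h2 := h.alphaG_bounds.1
    rw [errorBound]
    nlinarith

theorem steadyError_pos (h : SmallDrift c2 rho d U e0) : 0 < steadyError c2 rho d U := by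
  have h1 := h.betaG_ge.2
  have h2 := mul_pos h.rho_pos h.d_pos
  exact div_pos (by linarith) (by linarith [h.alphaG_bounds.2])

/-- The error bounds dominate the uncertainty and the drift, and change slowly. -/
theorem errorBound_bounds (h : SmallDrift c2 rho d U e0) (r : ℕ) :
    0 < errorBound c2 rho d U e0 r ∧ 8192 * U ≤ errorBound c2 rho d U e0 r ∧
    135168 * (rho * d) ≤ errorBound c2 rho d U e0 r ∧
    (1 - 1 / 4096) * errorBound c2 rho d U e0 r ≤ errorBound c2 rho d U e0 (r + 1) ∧
    errorBound c2 rho d U e0 (r + 1) ≤ errorBound c2 rho d U e0 r := by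
  have h1 := h.steadyError_mul
  have h2 := h.steadyError_le_errorBound r
  have h3 := h.steadyError_pos
  obtain ⟨h4, h5⟩ := h.alphaG_bounds
  obtain ⟨h6, h7⟩ := h.betaG_ge
  have hU := h.U_nonneg
  have hρd := mul_pos h.rho_pos h.d_pos
  -- With `betaG_ge`, this gives the factors `8192 = 2 * 4096` and `135168 = 33 * 4096`.
  have hβ : 4096 * betaG c2 rho d U ≤ steadyError c2 rho d U := by nlinarith
  refine ⟨by linarith, by linarith, by linarith, ?_, ?_⟩
  · rw [errorBound]; nlinarith
  · rw [errorBound]; nlinarith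

/-! ### Verification of the conditions on the phase lengths. -/

theorem regular (h : SmallDrift c2 rho d U e0) (n f : ℕ) (kappa delta : ℝ) :
    (paramsOf n f c2 rho d U e0 kappa delta).Regular := by
  have h1 := h.phi_pos
  have h2 := h.mu_pos
  have h3 := h.one_lt_thetaG
  have h4 := h.c1_pos
  have hN : 0 < zetaMax c2 rho * thetaG c2 rho := by
    rw [zetaMax]; positivity
  have he := fun r => (h.errorBound_bounds r).1
  exact ⟨h.rho_pos, h2, h1, fun r => mul_pos hN (he r),
    fun r => mul_pos hN (add_pos (he r) h.d_pos), fun r => by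
      change 0 < c1 c2 rho * zetaMax c2 rho * thetaG c2 rho * _
      rw [mul_assoc (c1 c2 rho)]
      exact mul_pos (mul_pos h4 hN) (add_pos_of_pos_of_nonneg (he r) h.U_nonneg)⟩

theorem phaseUnit_eq (c2 rho : ℝ) : zetaMax c2 rho * thetaG c2 rho =
    (1 + phiOf c2 rho) * (1 + muOf c2 rho) * (1 + rho) * (1 + muOf c2 rho) := by
  rw [zetaMax, thetaG]; ring

theorem sum_phases_eq (h : SmallDrift c2 rho d U e0) (e e' : ℝ) :
    (zetaMax c2 rho * thetaG c2 rho * (e + d) +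
      c1 c2 rho * zetaMax c2 rho * thetaG c2 rho * (e + U) +
      zetaMax c2 rho * thetaG c2 rho * e') / (1 + phiOf c2 rho) =
    (1 + muOf c2 rho) * thetaG c2 rho * (e + d + c1 c2 rho * (e + U) + e') := by
  have : 1 + phiOf c2 rho ≠ 0 := by linarith [h.phi_pos]
  rw [zetaMax]
  field_simp

theorem phase1_eq (h : SmallDrift c2 rho d U e0) (e : ℝ) :
    zetaMax c2 rho * thetaG c2 rho * e / (1 + phiOf c2 rho) =
      (1 + muOf c2 rho) * thetaG c2 rho * e := by
  have : 1 + phiOf c2 rho ≠ 0 := by linarith [h.phi_pos]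
  rw [zetaMax]
  field_simp

theorem fits (h : SmallDrift c2 rho d U e0) (n f : ℕ) (kappa delta : ℝ) :
    (paramsOf n f c2 rho d U e0 kappa delta).Fits (errorBound c2 rho d U e0) := by
  have h1 := h.phi_pos
  have h2 := h.mu_pos
  have h3 := h.one_lt_thetaG
  have h4 := h.one_lt_c1
  have hρ := h.rho_pos
  have hmax : 0 < (1 + phiOf c2 rho) * (1 + muOf c2 rho) * (1 + rho) := by positivity
  have hdrift : (1 - 1 / thetaG c2 rho) * ((1 + muOf c2 rho) * thetaG c2 rho) = gammaG c2 rho := by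
    have : thetaG c2 rho ≠ 0 := by linarith
    rw [h.gammaG_eq]
    field_simp
  refine ⟨h.regular n f kappa delta, h.U_nonneg, h.U_le, fun r => (h.errorBound_bounds r).1.le,
    fun r => ?_, fun r => ?_, fun r => ?_, ?_, fun r => ?_⟩
  · have he := (h.errorBound_bounds r).1
    change (1 + phiOf c2 rho) * (1 + muOf c2 rho) * (1 + rho) * _ ≤
      zetaMax c2 rho * thetaG c2 rho * _
    rw [phaseUnit_eq]
    refine mul_le_mul_of_nonneg_right (le_mul_of_one_le_right hmax.le (by linarith)) he.le
  · have he := (h.errorBound_bounds r).1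
    have hd := h.d_pos
    change (1 + phiOf c2 rho) * (1 + muOf c2 rho) * (1 + rho) * _ <
      zetaMax c2 rho * thetaG c2 rho * _
    rw [phaseUnit_eq]
    exact mul_lt_mul_of_pos_right (lt_mul_of_one_lt_right hmax (by linarith)) (add_pos he hd)
  · have he := (h.errorBound_bounds r).1
    have hU := h.U_nonneg
    change (1 + phiOf c2 rho) * (1 + muOf c2 rho) * (1 + rho) * _ <
      c1 c2 rho * zetaMax c2 rho * thetaG c2 rho * _
    rw [mul_assoc (c1 c2 rho), phaseUnit_eq]
    refine mul_lt_mul_of_pos_right ?_ (add_pos_of_pos_of_nonneg he hU)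
    nlinarith [mul_pos hmax h2]
  · have he := (h.errorBound_bounds 0).1
    change (1 - 1 / thetaG c2 rho) *
      (zetaMax c2 rho * thetaG c2 rho * errorBound c2 rho d U e0 0 / (1 + phiOf c2 rho)) ≤ _
    rw [h.phase1_eq, ← mul_assoc, hdrift]
    exact mul_le_of_le_one_left he.le (by linarith [h.gammaG_bounds.2])
  · have he := (h.errorBound_bounds r).1
    have hU := h.U_nonneg
    change errorBound c2 rho d U e0 r / 2 + 2 * U + (thetaG c2 rho - 1) *
      (3 / 2 * errorBound c2 rho d U e0 r + U) + (1 - 1 / thetaG c2 rho) * ((_ + _ + _) / _) ≤ _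
    refine (add_le_add_right (congrArg _ (h.sum_phases_eq (errorBound c2 rho d U e0 r)
      (errorBound c2 rho d U e0 (r + 1)))).le _).trans ?_
    rw [← mul_assoc, hdrift]
    -- Phase 1 of the next round is proportional to `e (r + 1)`, so its drift `γ e (r + 1)` is moved
    -- to the left; this is the origin of the denominators `1 - γ`.
    have e1 : (1 - gammaG c2 rho) * errorBound c2 rho d U e0 (r + 1) =
        (1 - gammaG c2 rho) * alphaG c2 rho * errorBound c2 rho d U e0 r +
          (1 - gammaG c2 rho) * betaG c2 rho d U := by
      rw [errorBound]; ring
    rw [h.alphaG_mul, h.betaG_mul] at e1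
    have e2 := mul_le_mul_of_nonneg_right h.midpoint_factor_bounds.1 he.le
    have e3 : 0 ≤ (thetaG c2 rho - 1) * U := mul_nonneg (by linarith) hU
    linarith

/-- The corrections of nodes in the same mode are small compared to phase 3. -/
theorem correction_le (h : SmallDrift c2 rho d U e0) (r : ℕ) :
    (1 + phiOf c2 rho) * (1 + muOf c2 rho) * (1 + rho) *
        (1 / 20 * errorBound c2 rho d U e0 r + U)
      ≤ 1037 / 10000 * muOf c2 rho *
        (c1 c2 rho * zetaMax c2 rho * thetaG c2 rho * (errorBound c2 rho d U e0 r + U)) := by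
  obtain ⟨he, heU, -⟩ := h.errorBound_bounds r
  have hU := h.U_nonneg
  have h1 := h.phi_pos
  have h2 := h.mu_pos
  have hρ := h.rho_pos
  have hc1 := h.c1_pos
  have h3 := h.rho_le_mu
  have hM : 0 < (1 + phiOf c2 rho) * (1 + muOf c2 rho) * (1 + rho) := by positivity
  -- Since `32 ρ ≤ μ`, at least `32/33` of `ρ + μ` is `μ`. Now `0.05` divided by this bound is about
  -- `0.1032`, and `0.1037` leaves room for `U ≤ e / 8192`.
  have hμc : 2047 / 4096 * 32 / 33 ≤ c1 c2 rho * muOf c2 rho := by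
    have := h.c1_mul
    nlinarith
  set e := errorBound c2 rho d U e0 r
  rw [mul_assoc (c1 c2 rho), phaseUnit_eq]
  set M := (1 + phiOf c2 rho) * (1 + muOf c2 rho) * (1 + rho)
  have e1 : 1 / 20 * e + U ≤ 1037 / 10000 * (c1 c2 rho * muOf c2 rho) * (e + U) := by
    nlinarith
  have e2 : M * (1 / 20 * e + U) ≤
      M * (1037 / 10000 * (c1 c2 rho * muOf c2 rho) * (e + U)) :=
    mul_le_mul_of_nonneg_left e1 hM.le
  have e3 : 0 ≤ M * (1037 / 10000 * (c1 c2 rho * muOf c2 rho) * (e + U)) * muOf c2 rho := by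
    positivity
  linarith

theorem tuned (h : SmallDrift c2 rho d U e0) (n f : ℕ) (kappa delta : ℝ) :
    (paramsOf n f c2 rho d U e0 kappa delta).Tuned (errorBound c2 rho d U e0) := by
  have h1 := h.phi_pos
  have h2 := h.mu_pos
  have h3 := h.mu_le
  have h4 := h.rho_le_mu
  have hρ := h.rho_pos
  have hθ1 := h.one_lt_thetaG
  have hθ2 := h.thetaG_le
  have hd := h.d_pos
  have hU := h.U_nonneg
  have hc1 := h.c1_pos
  have hc1ρ := h.c1_mul_rho_le
  have hreg := h.regular n f kappa delta
  have hdrift : 1 - 1 / (1 + rho) ≤ rho := by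
    have : 1 - 1 / (1 + rho) = rho / (1 + rho) := by field_simp; ring
    rw [this]
    exact div_le_self hρ.le (by linarith)
  have hκ : 0 ≤ (1 + muOf c2 rho) * thetaG c2 rho ∧
      (1 + muOf c2 rho) * thetaG c2 rho ≤ 1001 / 1000 := by
    constructor
    · positivity
    · nlinarith
  refine ⟨h.fits n f kappa delta, hd, fun r => (h.errorBound_bounds r).1, ?_, fun r q hq0 hq1 => ?_,
    fun r => ?_, fun r => ?_, fun r => ?_, fun r => ?_⟩
  · have he := (h.errorBound_bounds 0).1
    change (1 - 1 / (1 + rho)) *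
      (zetaMax c2 rho * thetaG c2 rho * errorBound c2 rho d U e0 0 / (1 + phiOf c2 rho)) ≤ _
    rw [h.phase1_eq, ← mul_assoc]
    refine mul_le_mul_of_nonneg_right ?_ he.le
    have := mul_le_mul hdrift hκ.2 hκ.1 hρ.le
    linarith
  · obtain ⟨he, heU, hed, he1, he2⟩ := h.errorBound_bounds r
    change q * errorBound c2 rho d U e0 r / 2 + 2 * U + (1 + rho - 1) *
      (3 / 2 * (q * errorBound c2 rho d U e0 r) + U) + (1 - 1 / (1 + rho)) * ((_ + _ + _) / _) ≤ _
    refine (add_le_add_right (congrArg _ (h.sum_phases_eq (errorBound c2 rho d U e0 r)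
      (errorBound c2 rho d U e0 (r + 1)))).le _).trans ?_
    set e := errorBound c2 rho d U e0 r
    set e' := errorBound c2 rho d U e0 (r + 1)
    have he' : 0 < e' := by linarith
    have hS : 0 ≤ e + d + c1 c2 rho * (e + U) + e' := by positivity
    have t1 : (1 - 1 / (1 + rho)) * ((1 + muOf c2 rho) * thetaG c2 rho *
        (e + d + c1 c2 rho * (e + U) + e')) ≤
        1001 / 1000 * (rho * (e + d + c1 c2 rho * (e + U) + e')) := by
      have a1 := mul_le_mul hdrift (mul_le_mul_of_nonneg_right hκ.2 hS)
        (mul_nonneg hκ.1 hS) hρ.le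
      linarith
    -- The main term is `c₁ ρ ≤ 2047 / (33 * 4096)`, about `0.01515`; the others fit into the
    -- remainder.
    have t2 : rho * (e + d + c1 c2 rho * (e + U) + e') ≤ 153 / 10000 * e := by
      have a1 : rho * e ≤ 1 / 1000000 * e := mul_le_mul_of_nonneg_right (by linarith) he.le
      have a2 : rho * e' ≤ 1 / 1000000 * e := by
        have := mul_le_mul_of_nonneg_left he2 hρ.le
        linarith
      have a3 := mul_le_mul_of_nonneg_right hc1ρ (by positivity : 0 ≤ e + U)
      nlinarith
    have hqe : 0 ≤ q * e := mul_nonneg hq0 he.le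
    have t3 : rho * (3 / 2 * (q * e) + U) ≤ 1 / 1000000 * (3 / 2 * (q * e) + U) :=
      mul_le_mul_of_nonneg_right (by linarith) (by positivity)
    have t4 : (51 / 100 * q + 16 / 1000) * ((1 - 1 / 4096) * e) ≤
        (51 / 100 * q + 16 / 1000) * e' := mul_le_mul_of_nonneg_left he1 (by positivity)
    linarith
  · have hτ := hreg.tau3_pos r
    have hw := h.correction_le r
    change (1 + rho) * (c1 c2 rho * zetaMax c2 rho * thetaG c2 rho * _) ≤
      (1 + 1 / 4 * muOf c2 rho) * (c1 c2 rho * zetaMax c2 rho * thetaG c2 rho * _ -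
        (1 + phiOf c2 rho) * (1 + muOf c2 rho) * (1 + rho) * _)
    change 0 < c1 c2 rho * zetaMax c2 rho * thetaG c2 rho * (errorBound c2 rho d U e0 r + U) at hτ
    set τ := c1 c2 rho * zetaMax c2 rho * thetaG c2 rho * (errorBound c2 rho d U e0 r + U)
    refine le_trans ?_ (mul_le_mul_of_nonneg_left (sub_le_sub_left hw τ) (by positivity))
    -- To first order `1/32 < 1/4 - 0.1037`.
    have : 1 + rho ≤ (1 + 1 / 4 * muOf c2 rho) * (1 - 1037 / 10000 * muOf c2 rho) := by nlinarith
    have := mul_le_mul_of_nonneg_right this hτ.le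
    linarith
  · have hτ := hreg.tau3_pos r
    have hw := h.correction_le r
    change (1 + 7 / 8 * muOf c2 rho) * (c1 c2 rho * zetaMax c2 rho * thetaG c2 rho * _ +
        (1 + phiOf c2 rho) * (1 + muOf c2 rho) * (1 + rho) * _) ≤
      (1 + muOf c2 rho) * (c1 c2 rho * zetaMax c2 rho * thetaG c2 rho * _)
    change 0 < c1 c2 rho * zetaMax c2 rho * thetaG c2 rho * (errorBound c2 rho d U e0 r + U) at hτ
    set τ := c1 c2 rho * zetaMax c2 rho * thetaG c2 rho * (errorBound c2 rho d U e0 r + U)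
    refine le_trans (mul_le_mul_of_nonneg_left (add_le_add_right hw τ) (by positivity)) ?_
    -- To first order `7/8 + 0.1037 < 1`.
    have : (1 + 7 / 8 * muOf c2 rho) * (1 + 1037 / 10000 * muOf c2 rho) ≤ 1 + muOf c2 rho := by
      nlinarith
    have := mul_le_mul_of_nonneg_right this hτ.le
    linarith
  · have he := (h.errorBound_bounds r).1
    change (1 + phiOf c2 rho) * (1 + muOf c2 rho) * (1 + rho) *
        (errorBound c2 rho d U e0 r + U) ≤
      phiOf c2 rho * (c1 c2 rho * zetaMax c2 rho * thetaG c2 rho * _)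
    rw [show phiOf c2 rho * (c1 c2 rho * zetaMax c2 rho * thetaG c2 rho *
      (errorBound c2 rho d U e0 r + U)) = c1 c2 rho * phiOf c2 rho *
        (zetaMax c2 rho * thetaG c2 rho) * (errorBound c2 rho d U e0 r + U) by ring,
      h.c1_mul_phi, one_mul, phaseUnit_eq]
    exact mul_le_mul_of_nonneg_right (le_mul_of_one_le_right (by positivity) (by linarith))
      (by linarith)
  · have he := (h.errorBound_bounds r).1
    change (1 + phiOf c2 rho) * (1 + muOf c2 rho) * (1 + rho) *
      (c1 c2 rho * zetaMax c2 rho * thetaG c2 rho * _) ≤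
      (1 + phiOf c2 rho) * (1 + 1 / 4 * muOf c2 rho) *
        ((1 + phiOf c2 rho) * (1 + 7 / 8 * muOf c2 rho)) *
      (c1 c2 rho * zetaMax c2 rho * thetaG c2 rho * _ -
        (1 + phiOf c2 rho) * (1 + muOf c2 rho) * (1 + rho) *
          (errorBound c2 rho d U e0 r + U))
    have hφ := h.phi_mul
    have hcφ := h.c1_mul_phi
    rw [mul_assoc (c1 c2 rho), phaseUnit_eq]
    set e := errorBound c2 rho d U e0 r
    set φ := phiOf c2 rho
    set μ := muOf c2 rho
    set c := c1 c2 rho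
    have hφμ : φ ≤ 207 / 100 * μ := by linarith
    -- To first order `φ` cancels on the right, leaving `2 μ + ρ` against `17/8 μ`, where `ρ ≤ μ /
    -- 32`.
    have key : (1 + μ) * (1 + rho) * (1 + μ) ≤
        (1 + 1 / 4 * μ) * (1 + 7 / 8 * μ) * ((1 + φ) * (1 + μ - φ)) := by
      have k1 : 1 + 9 / 8 * μ ≤ (1 + 1 / 4 * μ) * (1 + 7 / 8 * μ) := by nlinarith
      have k2 : 1 + μ - 1 / 100 * μ ≤ (1 + φ) * (1 + μ - φ) := by nlinarith
      have k3 : (1 + 9 / 8 * μ) * (1 + μ - 1 / 100 * μ) ≤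
          (1 + 1 / 4 * μ) * (1 + 7 / 8 * μ) * ((1 + φ) * (1 + μ - φ)) :=
        mul_le_mul k1 k2 (by linarith) (by positivity)
      have k4 : (1 + μ) * (1 + rho) * (1 + μ) ≤ (1 + 9 / 8 * μ) * (1 + μ - 1 / 100 * μ) := by
        nlinarith [mul_pos h2 h2, mul_pos hρ h2]
      linarith
    have hpos : 0 ≤ (1 + φ) * (1 + φ) * (1 + μ) * (1 + rho) * c * (e + U) := by positivity
    have hk := mul_le_mul_of_nonneg_left key hpos
    have e1 : (1 + φ) * (1 + μ) * (1 + rho) * (c * ((1 + φ) * (1 + μ) * (1 + rho) * (1 + μ)) *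
        (e + U)) = (1 + φ) * (1 + φ) * (1 + μ) * (1 + rho) * c * (e + U) *
          ((1 + μ) * (1 + rho) * (1 + μ)) := by ring
    have e2 : (1 + φ) * (1 + 1 / 4 * μ) * ((1 + φ) * (1 + 7 / 8 * μ)) *
        (c * ((1 + φ) * (1 + μ) * (1 + rho) * (1 + μ)) * (e + U) -
          (1 + φ) * (1 + μ) * (1 + rho) * (e + U)) =
        (1 + φ) * (1 + φ) * (1 + μ) * (1 + rho) * c * (e + U) *
          ((1 + 1 / 4 * μ) * (1 + 7 / 8 * μ) * ((1 + φ) * (1 + μ - φ))) := by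
      -- Inserting `c₁ φ = 1` makes the maximal correction a multiple of the same product as `τ₃`,
      -- so their difference gets the factor `1 + μ - φ`.
      have : (1 + φ) * (1 + μ) * (1 + rho) * (e + U) =
          c * φ * ((1 + φ) * (1 + μ) * (1 + rho) * (e + U)) := by rw [hcφ, one_mul]
      rw [this]
      ring
    rw [e1, e2]
    exact hk

end SmallDrift

end ClusterGCS

end

theorem mainTheorem3 (c2 : ℝ) (hc2 : 32 ≤ c2) :
    ∃ rho0 : ℝ, 0 < rho0 ∧ ∃ k0 : ℕ,
      ∀ (C : Type*) (G : SimpleGraph C) (n f : ℕ) (rho d U e0 kappa delta : ℝ)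
        (F : Set (ClusterGCS.Node C n)) (k : ℕ)
        (X : ClusterGCS.Trace C (ClusterGCS.paramsOf n f c2 rho d U e0 kappa delta)),
        3 * f + 1 ≤ n →
        (∀ A : C, {i : Fin n | (A, i) ∈ F}.ncard ≤ f) →
        0 < rho → rho ≤ rho0 →
        0 < d → 0 ≤ U → U ≤ d →
        ClusterGCS.steadyError c2 rho d U ≤ e0 →
        0 ≤ delta → 2 * delta < kappa →
        k0 ≤ k →
        X.IsExecution G F →
        X.IsFaithful G F k →
        ClusterGCS.GCSAxioms G kappa
            ((1 + ClusterGCS.phiOf c2 rho) * (1 + 1 / 4 * ClusterGCS.muOf c2 rho) - 1)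
            ((1 + ClusterGCS.phiOf c2 rho) * (1 + 7 / 8 * ClusterGCS.muOf c2 rho) - 1)
            (X.clusterClock F) ∧
          ClusterGCS.ImplementsGCS G kappa (X.clusterClock F) := by
  have hc2' : 0 < c2 := by linarith
  -- This `ρ₀` gives `μ ≤ 10⁻⁶`; `8` is six rounds of contraction plus two for the offset between
  -- nodes.
  refine ⟨1 / 1000000 / c2, by positivity, 8, ?_⟩
  intro C G n f rho d U e0 kappa delta F k X hn hF hrho hrho0 hd hU hUd he0 hδ hκ hk hX hfaith
  have hmu : ClusterGCS.muOf c2 rho ≤ 1 / 1000000 := by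
    rw [ClusterGCS.muOf, mul_comm]
    exact (le_div_iff₀ hc2').1 hrho0
  have hP := ClusterGCS.SmallDrift.tuned ⟨hc2, hrho, hmu, hd, hU, hUd, he0⟩ n f kappa delta
  have h := ClusterGCS.Trace.gcsAxioms_clusterClock hP ⟨hn, hF⟩ hX hκ hδ hk hfaith
  exact ⟨h, _, _, h⟩
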